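/- Let $S^2=\mathbb{C}\cup\{N\}$ be the Riemann sphere, with coordinate $z$ on $S^2\setminus\{N\}$ and $w=1/z$ near the north pole $N$. Let $L_1,L_2$ be holomorphic line bundles over $S^2$, put $L=L_2\otimes L_1^*$ and $k=\deg L=\deg L_2-\deg L_1$, and assume $k\ge 3$. Each $L_i$ is taken with its canonical meromorphic section $\zeta_{L_i}$, which is regular on $S^2\setminus\{N\}$ and equals $w^{\deg L_i}$ times a holomorphic frame near $N$; $\zeta_L$ and $\zeta_{L^*}$ are the induced sections of $L$ and $L^*$. Let $\mathcal H^{0,1}(L^*)=\Omega^{0,1}(L^*)/D''\Omega^0(L^*)$, which parametrizes the extensions $0\to L_1\to E\to L_2\to 0$: to $[\eta]$ corresponds $E=L_1\oplus L_2$ with $D''_\eta(\psi_1,\psi_2)=(D''\psi_1+\eta\psi_2,\,D''\psi_2)$. Let $\operatorname{div}[\eta]$ be the supremum of the degrees of the holomorphic line subbundles of $E$. Let $\mathbb P^{0,1}(L^*)$ be the projectivization of $\mathcal H^{0,1}(L^*)$ and $$\mathbb P^{0,1}(L^*)_1=\{[\eta]\in\mathbb P^{0,1}(L^*)\mid \operatorname{div}[\eta]\ge\deg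 L_2-1\}.$$ Let $\mathcal H^{1,0}(L)$ be the space of holomorphic sections of $T^{1,0}S^2\otimes L$, and let $H_0$ be the metric on $L$ with $|\zeta_L|_{H_0}^2=(1+|z|^2)^{-k}$, so that the $H_0$-dual of $\phi=g\,\zeta_L\,dz$ is $\phi^{*H_0}=\bar g\,(1+|z|^2)^{-k}\,\zeta_{L^*}\,d\bar z$. Then: 1. The numbers $b_j([\eta])=\int_{S^2} i\,(z^{j-1}\zeta_L\,dz)\wedge\eta$, $1\le j\le k-1$, depend only on the class $[\eta]$ and are linear coordinates on $\mathcal H^{0,1}(L^*)$. They identify $\mathbb P^{0,1}(L^*)$ with $\mathbb{CP}^{k-2}$ and give it its complex structure. 2. For $[\eta]\ne 0$ one has $[\eta]\in\mathbb P^{0,1}(L^*)_1$ if and only if $\operatorname{div}[\eta]=\deg L_2-1$. 3. There is a holomorphic embedding $\Psi:\mathbb{CP}^1\to\mathbb P^{0,1}(L^*)$ with image exactly $\mathbb P^{0,1}(L^*)_1$ (hence a diffeomorphism onto $\mathbb P^{0,1}(L^*)_1$). In the homogeneous coordinates $[b_1:\dots:b_{k-1}]$ it is $$\Psi[s:t]=[s^{k-2}:s^{k-3}t:\cdots:s\,t^{k-3}:t^{k-2}],$$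 that is, the coordinates of the classes in $\mathbb P^{0,1}(L^*)_1$ are in geometric progression. 4. The map $\phi\mapsto[\phi^{*H_0}]$, $\mathcal H^{1,0}(L)\to\mathcal H^{0,1}(L^*)$, is bijective. If $[\phi^{*H_0}]$ represents a point of $\mathbb P^{0,1}(L^*)_1$, then the divisor of $\phi$ is $(k-2)\,x$ for some point $x\in S^2$. -/

import Mathlib

open scoped ContDiff Manifold Topology ComplexConjugate

noncomputable section

/-! ## Complex projective space as a complex manifold -/

namespace CPn

/-- The quotient topology on `ℂPⁿ = (ℂⁿ⁺¹ ∖ 0) / ℂˣ`. -/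
instance topology (n : ℕ) : TopologicalSpace (Projectivization ℂ (Fin (n + 1) → ℂ)) :=
  TopologicalSpace.coinduced
    (fun v : {v : Fin (n + 1) → ℂ // v ≠ 0} => Projectivization.mk ℂ v.1 v.2) inferInstance

lemma isQuotientMap_mk (n : ℕ) : Topology.IsQuotientMap
    (fun v : {v : Fin (n + 1) → ℂ // v ≠ 0} => Projectivization.mk ℂ v.1 v.2) where
  surjective p := ⟨⟨p.rep, p.rep_nonzero⟩, p.mk_rep⟩
  eq_coinduced := rfl

variable {n : ℕ}

/-- The affine open set `{[v] | v i ≠ 0}`. -/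
def affineOpen (i : Fin (n + 1)) : Set (Projectivization ℂ (Fin (n + 1) → ℂ)) :=
  {p | p.rep i ≠ 0}

lemma mk_mem_affineOpen (i : Fin (n + 1)) (v : Fin (n + 1) → ℂ) (hv : v ≠ 0) :
    Projectivization.mk ℂ v hv ∈ affineOpen i ↔ v i ≠ 0 := by
  obtain ⟨a, ha⟩ := Projectivization.exists_smul_eq_mk_rep ℂ v hv
  simp [affineOpen, ← ha, Units.smul_def]

/-- The affine coordinates `[v] ↦ (v j / v i)_{j ≠ i}`. -/
def affineCoord (i : Fin (n + 1)) :
    Projectivization ℂ (Fin (n + 1) → ℂ) → (Fin n → ℂ) :=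
  Projectivization.lift (fun v j => v.1 (i.succAbove j) / v.1 i) (by
    rintro ⟨a, ha⟩ ⟨b, hb⟩ t h
    simp only at h
    have ht : t ≠ 0 := by rintro rfl; exact ha (by simpa using h)
    subst h
    funext j
    simp [mul_div_mul_left _ _ ht])

lemma insertNth_one_ne_zero (i : Fin (n + 1)) (x : Fin n → ℂ) :
    (i.insertNth (1 : ℂ) x : Fin (n + 1) → ℂ) ≠ 0 := by
  intro h
  have := congrFun h i
  simp at this

/-- The inverse of the affine coordinates: insert the coordinate `1` at place `i`. -/
def affineInv (i : Fin (n + 1)) (x : Fin n → ℂ) : Projectivization ℂ (Fin (n + 1) → ℂ) :=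
  Projectivization.mk ℂ (i.insertNth (1 : ℂ) x) (insertNth_one_ne_zero i x)

lemma contDiff_insertNth (i m : Fin (n + 1)) (N : WithTop ℕ∞) :
    ContDiff ℂ N (fun x : Fin n → ℂ => (i.insertNth (1 : ℂ) x : Fin (n + 1) → ℂ) m) := by
  rcases Fin.eq_self_or_eq_succAbove i m with rfl | ⟨j, rfl⟩
  · simpa using contDiff_const
  · simpa using contDiff_apply ℂ ℂ j

lemma isOpen_affineOpen (i : Fin (n + 1)) : IsOpen (affineOpen i) := by
  rw [← (isQuotientMap_mk n).isOpen_preimage]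
  have : ((fun v : {v : Fin (n + 1) → ℂ // v ≠ 0} => Projectivization.mk ℂ v.1 v.2) ⁻¹'
      affineOpen i) = {v | v.1 i ≠ 0} := by
    ext v
    exact mk_mem_affineOpen i v.1 v.2
  rw [this]
  exact isOpen_ne_fun ((continuous_apply i).comp continuous_subtype_val) continuous_const

/-- The standard affine chart of `ℂPⁿ` on the open set where the `i`-th coordinate is nonzero. -/
def affineChart (i : Fin (n + 1)) :
    OpenPartialHomeomorph (Projectivization ℂ (Fin (n + 1) → ℂ)) (Fin n → ℂ) where
  toFun := affineCoord i
  invFun := affineInv i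
  source := affineOpen i
  target := Set.univ
  map_source' _ _ := Set.mem_univ _
  map_target' x _ := (mk_mem_affineOpen i _ _).2 (by simp)
  left_inv' p := by
    induction p using Projectivization.ind with
    | h v hv =>
      intro hp
      rw [mk_mem_affineOpen] at hp
      refine (Projectivization.mk_eq_mk_iff' ℂ _ _ _ _).2 ⟨(v i)⁻¹, ?_⟩
      funext m
      rcases Fin.eq_self_or_eq_succAbove i m with rfl | ⟨j, rfl⟩
      · simp [hp]
      · simp [affineCoord, div_eq_inv_mul]
  right_inv' x _ := by
    funext j
    simp [affineCoord, affineInv]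
  open_source := isOpen_affineOpen i
  open_target := isOpen_univ
  continuousOn_toFun := by
    rw [continuousOn_iff_continuous_domRestrict,
      ((isQuotientMap_mk n).restrictPreimage_isOpen (isOpen_affineOpen i)).continuous_iff]
    refine continuous_pi fun j => ?_
    change Continuous fun v : ((fun v : {v : Fin (n + 1) → ℂ // v ≠ 0} =>
      Projectivization.mk ℂ v.1 v.2) ⁻¹' affineOpen i) => v.1.1 (i.succAbove j) / v.1.1 i
    have h (m : Fin (n + 1)) : Continuous fun v : ((fun v : {v : Fin (n + 1) → ℂ // v ≠ 0} =>
      Projectivization.mk ℂ v.1 v.2) ⁻¹' affineOpen i) => v.1.1 m :=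
        (continuous_apply m).comp (continuous_subtype_val.comp continuous_subtype_val)
    refine Continuous.div (h _) (h _) fun v => ?_
    exact (mk_mem_affineOpen i _ _).1 v.2
  continuousOn_invFun := by
    have h : Continuous fun x : Fin n → ℂ =>
        (⟨i.insertNth (1 : ℂ) x, insertNth_one_ne_zero i x⟩ : {v : Fin (n + 1) → ℂ // v ≠ 0}) :=
      Continuous.subtype_mk (continuous_pi fun m => (contDiff_insertNth i m 0).continuous) _
    exact ((isQuotientMap_mk n).continuous.comp h).continuousOn

lemma exists_mem_affineOpen (p : Projectivization ℂ (Fin (n + 1) → ℂ)) :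
    ∃ i, p ∈ affineOpen i :=
  Function.ne_iff.1 p.rep_nonzero

/-- The atlas of the `n + 1` standard affine charts. -/
instance chartedSpace (n : ℕ) :
    ChartedSpace (Fin n → ℂ) (Projectivization ℂ (Fin (n + 1) → ℂ)) where
  atlas := Set.range affineChart
  chartAt p := affineChart (exists_mem_affineOpen p).choose
  mem_chart_source p := (exists_mem_affineOpen p).choose_spec
  chart_mem_atlas _ := ⟨_, rfl⟩

/-- `ℂPⁿ` is a complex manifold. -/
instance isManifold (n : ℕ) :
    IsManifold 𝓘(ℂ, Fin n → ℂ) ω (Projectivization ℂ (Fin (n + 1) → ℂ)) := by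
  refine isManifold_of_contDiffOn _ _ _ ?_
  rintro _ _ ⟨i, rfl⟩ ⟨j, rfl⟩
  refine contDiffOn_pi.2 fun l => ?_
  change ContDiffOn ℂ ω (fun x : Fin n → ℂ =>
    (i.insertNth (1 : ℂ) x : Fin (n + 1) → ℂ) (j.succAbove l) /
      (i.insertNth (1 : ℂ) x : Fin (n + 1) → ℂ) j) _
  refine (contDiff_insertNth i _ ω).contDiffOn.div (contDiff_insertNth i _ ω).contDiffOn ?_
  rintro x ⟨⟨-, hx⟩, -⟩
  exact (mk_mem_affineOpen j _ _).1 hx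

end CPn

end

noncomputable section

/-! ## Line bundles, forms and Dolbeault cohomology on the sphere

The sphere `S²` is `OnePoint ℂ`. The point `∞` is the north pole `N`, the point `0` is the south
pole `S`; the stereographic coordinate is `z` on `S² ∖ N`, and `w = 1 / z` is the coordinate on
`S² ∖ S`.

The holomorphic line bundle `L` of degree `d` is given by its canonical holomorphic frames: `ζ_L`
over `S² ∖ N` and `ζ_{L,S}` over `S² ∖ S`, glued by `ζ_L = w ^ d • ζ_{L,S}`. (Up to isomorphism
there is exactly one holomorphic line bundle of each degree `d` on `S²`.) Frames of the dual
`L*`, of degree `-d`, are the dual frames, and if `L₁`, `L₂` have degrees `d₁`, `d₂`, then the frame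
`ζ₁ ⊗ ζ₂*` of `Hom (L₂, L₁) = L*`, `L = L₂ ⊗ L₁*`, is the frame for the degree `-(d₂ - d₁)`.

A section is recorded by its coefficients with respect to the frames over `S² ∖ N` (a function
of `z`) and over `S² ∖ S` (a function of `w`). -/

namespace Sphere

/-- The operator `∂/∂z̄ = (∂/∂x + i ∂/∂y) / 2`. -/
def dbar (f : ℂ → ℂ) (z : ℂ) : ℂ :=
  (fderiv ℝ f z 1 + Complex.I * fderiv ℝ f z Complex.I) / 2

lemma dbar_add {f g : ℂ → ℂ} {z : ℂ} (hf : DifferentiableAt ℝ f z) (hg : DifferentiableAt ℝ g z) :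
    dbar (f + g) z = dbar f z + dbar g z := by
  simp only [dbar, fderiv_add hf hg, add_apply]
  ring

lemma dbar_smul {f : ℂ → ℂ} {z : ℂ} (c : ℂ) (hf : DifferentiableAt ℝ f z) :
    dbar (c • f) z = c * dbar f z := by
  simp only [dbar, fderiv_const_smul hf, smul_apply, smul_eq_mul]
  ring

lemma dbar_zero (z : ℂ) : dbar 0 z = 0 := by
  simp [dbar]

lemma contDiff_dbar {f : ℂ → ℂ} (hf : ContDiff ℝ ∞ f) : ContDiff ℝ ∞ (dbar f) := by
  have h : ContDiff ℝ ∞ (fderiv ℝ f) := (contDiff_infty_iff_fderiv.1 hf).2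
  exact ((h.clm_apply contDiff_const).add
    (contDiff_const.mul (h.clm_apply contDiff_const))).div_const 2

/-- The chain rule for `∂/∂z̄` under `w = 1 / z`, with a holomorphic factor `w ^ d`. -/
lemma dbar_glue (d : ℤ) {f g : ℂ → ℂ} (hf : ContDiff ℝ ∞ f)
    (hg : ∀ w, w ≠ 0 → g w = w ^ d * f w⁻¹) {w : ℂ} (hw : w ≠ 0) :
    dbar g w = -(conj w ^ 2)⁻¹ * w ^ d * dbar f w⁻¹ := by
  set A := fderiv ℝ f w⁻¹ with hA
  have hfA : HasFDerivAt f A w⁻¹ := (hf.differentiable (by simp) _).hasFDerivAt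
  have h1 := (hasDerivAt_zpow d w (Or.inl hw)).hasFDerivAt.restrictScalars ℝ
  have h2 := (hasDerivAt_inv hw).hasFDerivAt.restrictScalars ℝ
  have h3 := h1.mul (hfA.comp w h2)
  have hev : g =ᶠ[𝓝 w] ((fun x => x ^ d) * f ∘ Inv.inv) := by
    filter_upwards [isOpen_ne.mem_nhds hw] with x hx
    exact hg x hx
  have hgw := (h3.congr_of_eventuallyEq hev).fderiv
  have hlin (c : ℂ) : A c = c.re * A 1 + c.im * A Complex.I := by
    have : c = c.re • (1 : ℂ) + c.im • Complex.I := by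
      simp [Complex.re_add_im]
    conv_lhs => rw [this, A.map_add, A.map_smul, A.map_smul]
    simp only [Complex.real_smul]
  have key (c : ℂ) : A c + Complex.I * A (Complex.I * c) =
      conj c * (A 1 + Complex.I * A Complex.I) := by
    rw [hlin c, hlin (Complex.I * c)]
    have hc : conj c = c.re - c.im * Complex.I := by
      apply Complex.ext <;> simp
    rw [hc]
    simp
    linear_combination ((c.im : ℂ) * A Complex.I) * Complex.I_sq
  have key' := key (-(w ^ 2)⁻¹)
  simp only [dbar, hgw, ← hA]
  simp at key' ⊢
  linear_combination (w ^ d / 2) * key' +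
    (d * w ^ (d - 1) * f w⁻¹ / 2) * Complex.I_sq

/-- Smooth sections of the complex line bundle on the sphere whose frames `e_N` over `S² ∖ N` and
`e_S` over `S² ∖ S` are glued by `e_N = τ(w) • e_S`. -/
def gluedSections (τ : ℂ → ℂ) : Submodule ℂ ((ℂ → ℂ) × (ℂ → ℂ)) where
  carrier := {s | ContDiff ℝ ∞ s.1 ∧ ContDiff ℝ ∞ s.2 ∧ ∀ w, w ≠ 0 → s.2 w = τ w * s.1 w⁻¹}
  zero_mem' := ⟨contDiff_const, contDiff_const, by simp⟩
  add_mem' := by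
    rintro s t ⟨h1, h2, h3⟩ ⟨k1, k2, k3⟩
    refine ⟨h1.add k1, h2.add k2, fun w hw => ?_⟩
    simp [h3 w hw, k3 w hw, mul_add]
  smul_mem' := by
    rintro c s ⟨h1, h2, h3⟩
    refine ⟨contDiff_const.smul h1, contDiff_const.smul h2, fun w hw => ?_⟩
    simp [h3 w hw, mul_left_comm]

/-- `Ω⁰(L)` for the line bundle `L` of degree `d`. -/
abbrev Omega00 (d : ℤ) : Submodule ℂ ((ℂ → ℂ) × (ℂ → ℂ)) :=
  gluedSections fun w => w ^ d

/-- `Ω^{1,0}(L)` for the line bundle `L` of degree `d`; the frames are `ζ_L dz` and `ζ_{L,S} dw`,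
and `dz = - w⁻² dw`. -/
abbrev Omega10 (d : ℤ) : Submodule ℂ ((ℂ → ℂ) × (ℂ → ℂ)) :=
  gluedSections fun w => -(w ^ 2)⁻¹ * w ^ d

/-- `Ω^{0,1}(L)` for the line bundle `L` of degree `d`; the frames are `ζ_L dz̄` and `ζ_{L,S} dw̄`,
and `dz̄ = - w̄⁻² dw̄`. -/
abbrev Omega01 (d : ℤ) : Submodule ℂ ((ℂ → ℂ) × (ℂ → ℂ)) :=
  gluedSections fun w => -(conj w ^ 2)⁻¹ * w ^ d

/-- The holomorphic structure `D'' : Ω⁰(L) → Ω^{0,1}(L)`. -/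
def delbar (d : ℤ) : Omega00 d →ₗ[ℂ] Omega01 d where
  toFun s := ⟨(dbar s.1.1, dbar s.1.2), contDiff_dbar s.2.1, contDiff_dbar s.2.2.1,
    fun _ hw => dbar_glue d s.2.1 s.2.2.2 hw⟩
  map_add' s t := by
    ext z
    · exact dbar_add (s.2.1.differentiable (by simp) z) (t.2.1.differentiable (by simp) z)
    · exact dbar_add (s.2.2.1.differentiable (by simp) z) (t.2.2.1.differentiable (by simp) z)
  map_smul' c s := by
    ext z
    · exact dbar_smul c (s.2.1.differentiable (by simp) z)
    · exact dbar_smul c (s.2.2.1.differentiable (by simp) z)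

/-- The Dolbeault cohomology `ℋ^{0,1}(L)`, `deg L = d`: every `(0,1)`-form is `D''`-closed. -/
abbrev H01 (d : ℤ) : Type := Omega01 d ⧸ LinearMap.range (delbar d)

/-- The class `[η] ∈ ℋ^{0,1}(L)`. -/
abbrev cls {d : ℤ} (η : Omega01 d) : H01 d := Submodule.Quotient.mk η

/-- The Dolbeault cohomology `ℋ^{1,0}(L)`, `deg L = d`: the `φ ∈ Ω^{1,0}(L)` with `D'' φ = 0`. -/
def H10 (d : ℤ) : Submodule ℂ (Omega10 d) where
  carrier := {φ | (∀ z, dbar φ.1.1 z = 0) ∧ ∀ w, dbar φ.1.2 w = 0}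
  zero_mem' := ⟨fun z => dbar_zero z, fun z => dbar_zero z⟩
  add_mem' := by
    rintro s t ⟨hs, hs'⟩ ⟨ht, ht'⟩
    refine ⟨fun z => ?_, fun z => ?_⟩
    · refine (dbar_add (s.2.1.differentiable (by simp) z)
        (t.2.1.differentiable (by simp) z)).trans ?_
      rw [hs, ht, add_zero]
    · refine (dbar_add (s.2.2.1.differentiable (by simp) z)
        (t.2.2.1.differentiable (by simp) z)).trans ?_
      rw [hs', ht', add_zero]
  smul_mem' := by
    rintro c s ⟨hs, hs'⟩
    refine ⟨fun z => ?_, fun z => ?_⟩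
    · refine (dbar_smul c (s.2.1.differentiable (by simp) z)).trans ?_
      rw [hs, mul_zero]
    · refine (dbar_smul c (s.2.2.1.differentiable (by simp) z)).trans ?_
      rw [hs', mul_zero]

/-- The order of vanishing at a point of `S²` of a holomorphic section of `T^{1,0} ⊗ L`. -/
def ordAt {d : ℤ} (φ : H10 d) (x : OnePoint ℂ) : WithTop ℤ :=
  x.elim (meromorphicOrderAt φ.1.1.2 0) (fun z => meromorphicOrderAt φ.1.1.1 z)

/-- `Div(φ) = D`. -/
def HasDivisor {d : ℤ} (φ : H10 d) (D : OnePoint ℂ →₀ ℤ) : Prop :=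
  ∀ x, ordAt φ x = (D x : WithTop ℤ)

/-- The section `z ^ j ζ_L dz` of `T^{1,0} ⊗ L`, `deg L = d`, for `0 ≤ j ≤ d - 2`. -/
def monomialSection (d : ℤ) (j : ℕ) (hj : (j : ℤ) ≤ d - 2) : Omega10 d :=
  ⟨(fun z => z ^ j, fun w => -w ^ (d - 2 - j).toNat), contDiff_id.pow j,
    (contDiff_id.pow _).neg, fun w hw => by
      have h : ((d - 2 - j).toNat : ℤ) = d - 2 - j := Int.toNat_of_nonneg (by omega)
      have h2 : w ^ (d - 2 - j).toNat = w ^ (d - 2 - j : ℤ) := by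
        rw [← h, zpow_natCast, h]
      simp only [h2, zpow_sub₀ hw, inv_pow, zpow_natCast]
      norm_cast
      field_simp⟩

/-- The coupling `((φ, η)) = ∫_{S²} i φ ∧ η`. In the coordinate `z = x + i y`, if `φ = g ζ_L dz` and
`η = a ζ_{L*} dz̄`, then `i φ ∧ η = g a i dz ∧ dz̄ = 2 g a dx dy`. -/
def coupling {d : ℤ} (φ : Omega10 d) (η : Omega01 (-d)) : ℂ :=
  ∫ z : ℂ, 2 * (φ.1.1 z * η.1.1 z)

lemma contDiff_one_add_normSq_zpow (d : ℤ) :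
    ContDiff ℝ ∞ fun z : ℂ => (1 + z * conj z) ^ d := by
  have hne (z : ℂ) : 1 + z * conj z ≠ 0 := by
    rw [Complex.mul_conj]
    have := Complex.normSq_nonneg z
    norm_cast
    positivity
  have hconj : ContDiff ℝ ∞ fun z : ℂ => conj z := Complex.conjCLE.contDiff
  have h1 : ContDiff ℝ ∞ fun z : ℂ => 1 + z * conj z := contDiff_const.add (contDiff_id.mul hconj)
  cases d with
  | ofNat m => simpa using h1.pow m
  | negSucc m =>
    simp only [zpow_negSucc]
    exact (h1.pow (m + 1)).inv fun z => pow_ne_zero _ (hne z)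

/-- The `H₀`-dual `φ ↦ φ^{*H₀} : Ω^{1,0}(L) → Ω^{0,1}(L*)`, `deg L = d`, for the metric `H₀` of
constant curvature: `|ζ_L|² = (1 + |z|²) ^ (-d)` and `|ζ_{L,S}|² = (1 + |w|²) ^ (-d)`. It sends
`g ζ_L dz` to `ḡ |ζ_L|² ζ_{L*} dz̄`. -/
def dualH0 {d : ℤ} (φ : Omega10 d) : Omega01 (-d) :=
  ⟨(fun z => conj (φ.1.1 z) * (1 + z * conj z) ^ (-d),
    fun w => conj (φ.1.2 w) * (1 + w * conj w) ^ (-d)),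
    (Complex.conjCLE.contDiff.comp φ.2.1).mul (contDiff_one_add_normSq_zpow _),
    (Complex.conjCLE.contDiff.comp φ.2.2.1).mul (contDiff_one_add_normSq_zpow _),
    fun w hw => by
      have hw' : conj w ≠ 0 := by simpa using hw
      have h : (1 + w⁻¹ * (conj w)⁻¹) = (1 + w * conj w) * w⁻¹ * (conj w)⁻¹ := by
        field_simp
        ring
      simp only [φ.2.2.2 w hw, map_mul, map_neg, map_inv₀, map_pow, map_zpow₀, h, mul_zpow,
        inv_zpow, zpow_neg]
      have := zpow_ne_zero d hw
      field_simp⟩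

/-! ## Extensions and holomorphic line subbundles

For `η ∈ Ω^{0,1}(L*)`, `L = L₂ ⊗ L₁*`, the extension `0 → L₁ → E → L₂ → 0` of class `[η]` is
`E = L₁ ⊕ L₂` with `D''_η (ψ₁, ψ₂) = (D'' ψ₁ + η ψ₂, D'' ψ₂)`. A section of `E` is recorded by
its two coefficients in the frame `ζ₁, ζ₂` (a function of `z`), and in the frame `ζ_{1,S}, ζ_{2,S}`
(a function of `w`). -/

/-- Over a coordinate domain, with `a` the coefficient of `η`: `ζ` is, near `z₀`, a regular
(nowhere vanishing) holomorphic section of `E` that spans the lines `J z`. -/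
def IsLocalFrame (a : ℂ → ℂ) (J : ℂ → Submodule ℂ (ℂ × ℂ)) (ζ : ℂ → ℂ × ℂ) (z₀ : ℂ) : Prop :=
  ∀ᶠ z in 𝓝 z₀, ContDiffAt ℝ ∞ ζ z ∧
    dbar (fun x => (ζ x).1) z + a z * (ζ z).2 = 0 ∧ dbar (fun x => (ζ x).2) z = 0 ∧
    ζ z ≠ 0 ∧ J z = Submodule.span ℂ {ζ z}

/-- A holomorphic line subbundle `J` of the extension `E` of `L₂` by `L₁` given by `η`. -/
structure HolLineSubbundle (d₁ d₂ : ℤ) (η : Omega01 (-(d₂ - d₁))) where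
  /-- The line over the point with coordinate `z`, in the frame `ζ₁, ζ₂`. -/
  lineN : ℂ → Submodule ℂ (ℂ × ℂ)
  /-- The line over the point with coordinate `w`, in the frame `ζ_{1,S}, ζ_{2,S}`. -/
  lineS : ℂ → Submodule ℂ (ℂ × ℂ)
  glue : ∀ w, w ≠ 0 → ∀ u v, (w ^ d₁ * u, w ^ d₂ * v) ∈ lineS w ↔ (u, v) ∈ lineN w⁻¹
  frameN : ∀ z₀, ∃ ζ, IsLocalFrame η.1.1 lineN ζ z₀
  frameS : ∀ w₀, ∃ ζ, IsLocalFrame η.1.2 lineS ζ w₀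

/-- A nonzero meromorphic section `ψ` of the line bundle `J ⊂ E` with its divisor: near
each point `x` it is `t ^ m ζ`, with `t` a holomorphic coordinate centered at `x`, `ζ` a regular
holomorphic section of `J` and `m` the order of `ψ` at `x`. The values of `ψ` at the points of the
divisor play no role. -/
structure MeroSection {d₁ d₂ : ℤ} {η : Omega01 (-(d₂ - d₁))} (J : HolLineSubbundle d₁ d₂ η) where
  /-- The section in the coordinate `z` and the frame `ζ₁, ζ₂`. -/
  secN : ℂ → ℂ × ℂ
  /-- The section in the coordinate `w` and the frame `ζ_{1,S}, ζ_{2,S}`. -/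
  secS : ℂ → ℂ × ℂ
  glue : ∀ w, w ≠ 0 → secS w = (w ^ d₁ * (secN w⁻¹).1, w ^ d₂ * (secN w⁻¹).2)
  /-- The divisor. -/
  divisor : OnePoint ℂ →₀ ℤ
  order_coe : ∀ z₀ : ℂ, ∃ ζ, IsLocalFrame η.1.1 J.lineN ζ z₀ ∧
    ∀ᶠ z in 𝓝[≠] z₀, secN z = (z - z₀) ^ divisor (z₀ : OnePoint ℂ) • ζ z
  order_infty : ∃ ζ, IsLocalFrame η.1.2 J.lineS ζ 0 ∧
    ∀ᶠ w in 𝓝[≠] (0 : ℂ), secS w = w ^ divisor OnePoint.infty • ζ w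

/-- `J` has degree `m`: some nonzero meromorphic section of `J` has a divisor of degree `m`. -/
def HolLineSubbundle.HasDegree {d₁ d₂ : ℤ} {η : Omega01 (-(d₂ - d₁))}
    (J : HolLineSubbundle d₁ d₂ η) (m : ℤ) : Prop :=
  ∃ ψ : MeroSection J, ψ.divisor.sum (fun _ c => c) = m

/-- `div[η] = div(E) = sup {deg J | J ⊂ E a holomorphic line subbundle}`, as an extended real. -/
def divExt (d₁ d₂ : ℤ) (η : Omega01 (-(d₂ - d₁))) : EReal :=
  sSup {r | ∃ (J : HolLineSubbundle d₁ d₂ η) (m : ℤ), J.HasDegree m ∧ r = ((m : ℝ) : EReal)}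

/-- The projectivization `ℙ^{0,1}(L*)` of `ℋ^{0,1}(L*)`, `L = L₂ ⊗ L₁*`. -/
abbrev P01 (d₁ d₂ : ℤ) : Type := Projectivization ℂ (H01 (-(d₂ - d₁)))

/-- `ℙ^{0,1}(L*)_m = {[η] | div[η] ≥ deg L₂ - m}`. -/
def P01Level (d₁ d₂ m : ℤ) : Set (P01 d₁ d₂) :=
  {p | ∀ (η : Omega01 (-(d₂ - d₁))) (hη : cls η ≠ 0), Projectivization.mk ℂ (cls η) hη = p →
    (((d₂ - m : ℤ) : ℝ) : EReal) ≤ divExt d₁ d₂ η}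

end Sphere

end

/-! ### The calculus of `∂/∂z̄` -/

namespace Sphere

open MeasureTheory Filter Set

/-! Write `k = n + 2`. The coordinates come from an explicit form of Serre duality on the sphere.
The `n + 1` moments `∫ z ^ j η` with `j ≤ n` vanish on `D''`-exact forms by Stokes' theorem
(`integral_pow_mul_dbar_eq_zero`). Conversely, the Cauchy transform of the coefficient of `η` solves
`∂f/∂z̄ = η` on the plane, and the vanishing of the moments is what makes this primitive extend over
the north pole as a section of `L*` (`cauchyTransform_mem`). So the moments are injective on
cohomology. They are onto because the `H₀`-duals of the monomials `z ^ j ζ_L dz` have a diagonal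
matrix of moments: rotations kill the entries off the diagonal, and a Stokes recursion shows that
the entry `j` is a nonzero constant divided by `n.choose j`. The same diagonal matrix makes `φ ↦
[φ^{*H₀}]` bijective.

A holomorphic line subbundle of degree `m` in `E` amounts to a pair `(F₁, F₂)` of sections of `L₁ ⊗
O(-m)` and `L₂ ⊗ O(-m)` without common zeros, where `F₂` is holomorphic and `D'' F₁ = -η F₂`. If `m
≥ deg L₂`, then `F₂` is zero or a constant. The first case forces `F₁ = 0`, the second makes `η`
exact; hence a nontrivial extension has only subbundles of degree at most `deg L₂ - 1`
(`degree_le`). For `m = deg L₂ - 1` the section `F₂ = s z - t` is a linear form, and `η F₂` is exact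
if and only if its `n` moments vanish, which reads `s b_{j+1} = t b_j`: the coordinates are in
geometric progression, with ratio the zero `t / s` of `F₂`. Conversely, such a progression produces
`F₁` as a Cauchy transform. Its value at the zero of `F₂` is a nonzero multiple of the first moment,
or of the last one if that zero is the north pole, so the pair has no common zero
(`exists_hasDegree`).

The level set is therefore the rational normal curve. It is an embedding because, in suitable affine
charts, it is a monomial curve with one coordinate equal to the parameter: a polynomial shear
straightens it to an axis. Finally, the binomial coefficients in the diagonal matrix turn a
geometric progression of moments into a polynomial `A (s̄ + t̄ z) ^ n`, whose divisor is
concentrated at one point. -/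

lemma dbar_eq_zero_iff {f : ℂ → ℂ} {z : ℂ} (hf : DifferentiableAt ℝ f z) :
    dbar f z = 0 ↔ DifferentiableAt ℂ f z := by
  rw [differentiableAt_complex_iff_differentiableAt_real, dbar]
  simp only [hf, true_and, smul_eq_mul, div_eq_zero_iff, OfNat.ofNat_ne_zero, or_false]
  constructor <;> intro h
  · linear_combination (-Complex.I) * h + fderiv ℝ f z Complex.I * Complex.I_sq
  · linear_combination Complex.I * h + fderiv ℝ f z 1 * Complex.I_sq

lemma dbar_eq_zero {f : ℂ → ℂ} {z : ℂ} (hf : DifferentiableAt ℂ f z) : dbar f z = 0 :=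
  (dbar_eq_zero_iff (hf.restrictScalars ℝ)).2 hf

lemma dbar_congr {f g : ℂ → ℂ} {z : ℂ} (h : f =ᶠ[𝓝 z] g) : dbar f z = dbar g z := by
  simp only [dbar, h.fderiv_eq]

lemma dbar_mul {f g : ℂ → ℂ} {z : ℂ} (hf : DifferentiableAt ℝ f z) (hg : DifferentiableAt ℝ g z) :
    dbar (fun x => f x * g x) z = f z * dbar g z + g z * dbar f z := by
  simp only [dbar, fderiv_fun_mul hf hg, add_apply, smul_apply, smul_eq_mul]
  ring

lemma dbar_holo_mul {f g : ℂ → ℂ} {z : ℂ} (hf : DifferentiableAt ℂ f z)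
    (hg : DifferentiableAt ℝ g z) : dbar (fun x => f x * g x) z = f z * dbar g z := by
  rw [dbar_mul (hf.restrictScalars ℝ) hg, dbar_eq_zero hf, mul_zero, add_zero]

lemma dbar_inv {f : ℂ → ℂ} {z : ℂ} (hf : DifferentiableAt ℝ f z) (h0 : f z ≠ 0) :
    dbar (fun x => (f x)⁻¹) z = -dbar f z / f z ^ 2 := by
  have h1 : DifferentiableAt ℝ (fun x => (f x)⁻¹) z := hf.inv h0
  have h2 : (fun x => f x * (f x)⁻¹) =ᶠ[𝓝 z] fun _ => 1 := by
    filter_upwards [hf.continuousAt.eventually_ne h0] with x hx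
    exact mul_inv_cancel₀ hx
  have h3 := dbar_mul hf h1
  rw [dbar_congr h2, dbar_eq_zero (differentiableAt_const _)] at h3
  field_simp at h3 ⊢
  linear_combination (-1) * h3

lemma dbar_pow {f : ℂ → ℂ} {z : ℂ} (hf : DifferentiableAt ℝ f z) (m : ℕ) :
    dbar (fun x => f x ^ (m + 1)) z = (m + 1) * f z ^ m * dbar f z := by
  induction m with
  | zero => simp
  | succ m ih =>
    have h : (fun x => f x ^ (m + 1 + 1)) = fun x => f x ^ (m + 1) * f x := by
      funext x; ring
    have hp : DifferentiableAt ℝ (fun x => f x ^ (m + 1)) z := hf.pow (m + 1)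
    rw [h, dbar_mul hp hf, ih]
    push_cast
    ring

lemma dbar_conj (z : ℂ) : dbar (fun x => conj x) z = 1 := by
  have h : fderiv ℝ (fun x : ℂ => conj x) z = Complex.conjCLE := Complex.conjCLE.fderiv
  simp [dbar, h]

lemma continuous_dbar {f : ℂ → ℂ} (hf : ContDiff ℝ ∞ f) : Continuous (dbar f) :=
  (contDiff_dbar hf).continuous

lemma norm_dbar_le {f : ℂ → ℂ} (z : ℂ) : ‖dbar f z‖ ≤ ‖fderiv ℝ f z‖ := by
  have h1 := (fderiv ℝ f z).le_opNorm 1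
  have h2 := (fderiv ℝ f z).le_opNorm Complex.I
  simp only [norm_one, mul_one, Complex.norm_I] at h1 h2
  rw [dbar, norm_div, Complex.norm_ofNat, div_le_iff₀ two_pos]
  refine (norm_add_le _ _).trans ?_
  rw [norm_mul, Complex.norm_I, one_mul]
  linarith

lemma dbar_eq_zero_of_notMem_tsupport {f : ℂ → ℂ} {z : ℂ} (hz : z ∉ tsupport f) : dbar f z = 0 := by
  rw [dbar_congr (notMem_tsupport_iff_eventuallyEq.1 hz), dbar_zero]

lemma hasCompactSupport_dbar {f : ℂ → ℂ} (hf : HasCompactSupport f) :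
    HasCompactSupport (dbar f) :=
  HasCompactSupport.intro hf fun _ hz => dbar_eq_zero_of_notMem_tsupport hz

/-- Integration by parts against the constant function `1`, in the directions `1` and `I`. -/
lemma integral_dbar_eq_zero_of_hasCompactSupport {f : ℂ → ℂ} (hf : ContDiff ℝ ∞ f)
    (hc : HasCompactSupport f) : ∫ z, dbar f z = 0 := by
  have hd : Continuous (fderiv ℝ f) := hf.continuous_fderiv (by simp)
  have hi (v : ℂ) : Integrable fun z => fderiv ℝ f z v :=
    (hd.clm_apply continuous_const).integrable_of_hasCompactSupport
      (hc.fderiv_apply ℝ v)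
  have h0 (v : ℂ) : ∫ z, fderiv ℝ f z v = 0 := by
    have := integral_mul_fderiv_eq_neg_fderiv_mul_of_integrable (μ := volume) (𝕜 := ℂ)
      (f := fun _ : ℂ => (1 : ℂ)) (g := f) (v := v) (by simp) (by simpa using hi v)
      (by simpa using hf.continuous.integrable_of_hasCompactSupport hc)
      (fun _ _ => differentiableAt_const _) (fun x _ => hf.differentiable (by simp) x)
    simpa using this
  simp only [dbar]
  rw [integral_div, integral_add (hi 1) ((hi _).const_mul _), integral_const_mul, h0, h0]
  simp

/-! ### Stokes' theorem for functions with quadratic decay -/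

/-- Any exponent below minus the real dimension, which is `-2`, would do. The exponent `-3` is the
first integer one. -/
lemma integrable_of_norm_le {f : ℂ → ℂ} (hf : AEStronglyMeasurable f) {C : ℝ}
    (h : ∀ z, ‖f z‖ ≤ C * (1 + ‖z‖) ^ (-3 : ℝ)) : Integrable f :=
  ((integrable_one_add_norm (E := ℂ) (μ := volume) (r := 3) (by
    rw [Complex.finrank_real_complex]; norm_num)).const_mul C).mono' hf (Eventually.of_forall h)

/-- A smooth function which is `1` on the unit ball and vanishes outside the ball of radius `2`. -/
noncomputable def cutoff : ContDiffBump (0 : ℂ) := ⟨1, 2, one_pos, one_lt_two⟩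

/-- The function `z ↦ χ (z / (m + 1))`, `χ` the cutoff function. -/
noncomputable def dilatedCutoff (m : ℕ) (z : ℂ) : ℂ := (cutoff (((m : ℝ) + 1)⁻¹ • z) : ℝ)

lemma contDiff_dilatedCutoff (m : ℕ) : ContDiff ℝ ∞ (dilatedCutoff m) :=
  Complex.ofRealCLM.contDiff.comp (cutoff.contDiff.comp (contDiff_const_smul _))

lemma dilatedCutoff_eq_one {m : ℕ} {z : ℂ} (hz : ‖z‖ ≤ m + 1) : dilatedCutoff m z = 1 := by
  rw [dilatedCutoff, cutoff.one_of_mem_closedBall, Complex.ofReal_one]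
  rw [mem_closedBall_zero_iff, norm_smul, norm_inv, Real.norm_of_nonneg (by positivity)]
  change _ ≤ (1 : ℝ)
  rwa [inv_mul_le_iff₀ (by positivity), mul_one]

lemma dilatedCutoff_eq_zero {m : ℕ} {z : ℂ} (hz : 2 * ((m : ℝ) + 1) ≤ ‖z‖) :
    dilatedCutoff m z = 0 := by
  rw [dilatedCutoff, cutoff.zero_of_le_dist, Complex.ofReal_zero]
  rw [dist_zero_right, norm_smul, norm_inv, Real.norm_of_nonneg (by positivity)]
  change (2 : ℝ) ≤ _
  rwa [le_inv_mul_iff₀ (by positivity), mul_comm]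

lemma norm_dilatedCutoff_le (m : ℕ) (z : ℂ) : ‖dilatedCutoff m z‖ ≤ 1 := by
  rw [dilatedCutoff, Complex.norm_real, Real.norm_of_nonneg cutoff.nonneg]
  exact cutoff.le_one

lemma hasCompactSupport_dilatedCutoff (m : ℕ) : HasCompactSupport (dilatedCutoff m) :=
  HasCompactSupport.intro (isCompact_closedBall (0 : ℂ) (2 * ((m : ℝ) + 1))) fun z hz =>
    dilatedCutoff_eq_zero (by
      rw [mem_closedBall_zero_iff, not_le] at hz
      exact hz.le)

lemma dbar_dilatedCutoff_of_lt {m : ℕ} {z : ℂ} (hz : ‖z‖ < m + 1) : dbar (dilatedCutoff m) z = 0 := by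
  have : dilatedCutoff m =ᶠ[𝓝 z] fun _ => 1 := by
    filter_upwards [continuous_norm.continuousAt.eventually_lt_const hz] with x hx
    exact dilatedCutoff_eq_one hx.le
  rw [dbar_congr this, dbar_eq_zero (differentiableAt_const _)]

/-- Dilation divides the derivative by `m + 1`, and the derivative lives where `‖z‖ ≤ 2 (m + 1)`, so
`(m + 1)⁻¹` can be traded for `(1 + ‖z‖)⁻¹` uniformly in `m`. -/
lemma exists_norm_dbar_dilatedCutoff_le :
    ∃ C : ℝ, 0 ≤ C ∧ ∀ m z, ‖dbar (dilatedCutoff m) z‖ ≤ C * (1 + ‖z‖)⁻¹ := by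
  set χ : ℂ → ℝ := fun z => cutoff z with hχ
  have hχs : ContDiff ℝ ∞ χ := cutoff.contDiff
  have hc : HasCompactSupport (fderiv ℝ χ) := cutoff.hasCompactSupport.fderiv ℝ
  obtain ⟨C, hC⟩ := (hχs.continuous_fderiv (by simp)).bounded_above_of_compact_support hc
  have hC0 : 0 ≤ C := (norm_nonneg _).trans (hC 0)
  -- The factor `3` comes from `1 + ‖z‖ ≤ 2 m + 3 ≤ 3 (m + 1)` where the cutoff is not locally zero.
  refine ⟨3 * C, by positivity, fun m z => ?_⟩
  have hm : (0 : ℝ) < m + 1 := by positivity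
  by_cases hz : 2 * ((m : ℝ) + 1) < ‖z‖
  · have : dilatedCutoff m =ᶠ[𝓝 z] 0 := by
      filter_upwards [continuous_norm.continuousAt.eventually_const_lt hz] with x hx
      exact dilatedCutoff_eq_zero hx.le
    rw [dbar_congr this, dbar_zero, norm_zero]
    positivity
  · have h1 : HasFDerivAt (dilatedCutoff m)
        (Complex.ofRealCLM.comp ((fderiv ℝ χ (((m : ℝ) + 1)⁻¹ • z)).comp
          (((m : ℝ) + 1)⁻¹ • ContinuousLinearMap.id ℝ ℂ))) z :=
      Complex.ofRealCLM.hasFDerivAt.comp z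
        (((hχs.differentiable (by simp) _).hasFDerivAt).comp z
          (((m : ℝ) + 1)⁻¹ • ContinuousLinearMap.id ℝ ℂ).hasFDerivAt)
    refine (norm_dbar_le z).trans ?_
    rw [h1.fderiv]
    refine (ContinuousLinearMap.opNorm_le_bound _ (M := C * ((m : ℝ) + 1)⁻¹) (by positivity)
      fun v => ?_).trans ?_
    · simp only [ContinuousLinearMap.comp_apply, Complex.ofRealCLM_apply, Complex.norm_real,
        smul_apply, ContinuousLinearMap.id_apply]
      refine (ContinuousLinearMap.le_opNorm _ _).trans ?_
      rw [norm_smul, norm_inv, Real.norm_of_nonneg hm.le, ← mul_assoc]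
      gcongr
      exact hC _
    · rw [mul_comm 3 C, mul_assoc]
      gcongr
      rw [← div_eq_mul_inv, inv_le_comm₀ hm (by positivity), inv_div, div_le_iff₀ (by norm_num)]
      have : (0 : ℝ) ≤ m := by positivity
      linarith

/-- Stokes' theorem on the plane. -/
lemma integral_dbar_eq_zero {f : ℂ → ℂ} (hf : ContDiff ℝ ∞ f) {C : ℝ}
    (hC : ∀ z, ‖f z‖ ≤ C * (1 + ‖z‖) ^ (-2 : ℝ)) (hi : Integrable (dbar f)) :
    ∫ z, dbar f z = 0 := by
  obtain ⟨D, hD0, hD⟩ := exists_norm_dbar_dilatedCutoff_le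
  have hd (z : ℂ) : DifferentiableAt ℝ f z := hf.differentiable (by simp) z
  have hχd (m : ℕ) (z : ℂ) : DifferentiableAt ℝ (dilatedCutoff m) z :=
    (contDiff_dilatedCutoff m).differentiable (by simp) z
  have hχc (m : ℕ) : Continuous (dilatedCutoff m) := (contDiff_dilatedCutoff m).continuous
  have hevm (z : ℂ) : ∀ᶠ m : ℕ in atTop, ‖z‖ < m + 1 := by
    obtain ⟨N, hN⟩ := exists_nat_gt ‖z‖
    filter_upwards [eventually_ge_atTop N] with m hm
    have : (N : ℝ) ≤ m := by exact_mod_cast hm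
    linarith
  have hC0 : 0 ≤ C := by
    have := (norm_nonneg _).trans (hC 0)
    simpa using this
  -- The boundary term of the truncated identity: quadratic decay of `f` times the decay of the
  -- derivative of the cutoff gives an integrable majorant independent of `m`. At each point the
  -- term vanishes for large `m`, so its integral tends to `0`.
  have hb (m : ℕ) (z : ℂ) : ‖f z * dbar (dilatedCutoff m) z‖ ≤
      C * D * (1 + ‖z‖) ^ (-3 : ℝ) := by
    have hp : (0 : ℝ) < 1 + ‖z‖ := by positivity
    have : (1 + ‖z‖) ^ (-3 : ℝ) = (1 + ‖z‖) ^ (-2 : ℝ) * (1 + ‖z‖)⁻¹ := by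
      rw [← Real.rpow_neg_one, ← Real.rpow_add hp]; norm_num
    rw [norm_mul, this]
    calc _ ≤ (C * (1 + ‖z‖) ^ (-2 : ℝ)) * (D * (1 + ‖z‖)⁻¹) :=
          mul_le_mul (hC z) (hD m z) (norm_nonneg _) (by positivity)
      _ = _ := by ring
  have h1 : Tendsto (fun m : ℕ => ∫ z, dilatedCutoff m z * dbar f z) atTop (𝓝 (∫ z, dbar f z)) := by
    refine tendsto_integral_of_dominated_convergence (fun z => ‖dbar f z‖)
      (fun m => ((hχc m).mul (continuous_dbar hf)).aestronglyMeasurable) hi.norm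
      (fun m => Eventually.of_forall fun z => ?_) (Eventually.of_forall fun z => ?_)
    · rw [norm_mul]
      exact mul_le_of_le_one_left (norm_nonneg _) (norm_dilatedCutoff_le m z)
    · refine tendsto_const_nhds.congr' ?_
      filter_upwards [hevm z] with m hm
      rw [dilatedCutoff_eq_one hm.le, one_mul]
  have hcont (m : ℕ) : Continuous fun z => f z * dbar (dilatedCutoff m) z :=
    hf.continuous.mul (continuous_dbar (contDiff_dilatedCutoff m))
  have h2 : Tendsto (fun m : ℕ => ∫ z, f z * dbar (dilatedCutoff m) z) atTop
      (𝓝 (∫ _ : ℂ, (0 : ℂ))) := by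
    refine tendsto_integral_of_dominated_convergence (fun z => C * D * (1 + ‖z‖) ^ (-3 : ℝ))
      (fun m => (hcont m).aestronglyMeasurable) ?_
      (fun m => Eventually.of_forall (hb m)) (Eventually.of_forall fun z => ?_)
    · exact (integrable_one_add_norm (by rw [Complex.finrank_real_complex]; norm_num)).const_mul _
    · refine tendsto_const_nhds.congr' ?_
      filter_upwards [hevm z] with m hm
      rw [dbar_dilatedCutoff_of_lt hm, mul_zero]
  have h3 (m : ℕ) : ∫ z, dilatedCutoff m z * dbar f z = -∫ z, f z * dbar (dilatedCutoff m) z := by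
    have h := integral_dbar_eq_zero_of_hasCompactSupport ((contDiff_dilatedCutoff m).mul hf)
      ((hasCompactSupport_dilatedCutoff m).mul_right)
    have h' : dbar (fun z => dilatedCutoff m z * f z) = fun z =>
        dilatedCutoff m z * dbar f z + f z * dbar (dilatedCutoff m) z := by
      funext z
      exact dbar_mul (hχd m z) (hd z)
    rw [h', integral_add] at h
    · exact eq_neg_of_add_eq_zero_left h
    · exact ((hχc m).mul (continuous_dbar hf)).integrable_of_hasCompactSupport
        ((hasCompactSupport_dilatedCutoff m).mul_right)
    · exact integrable_of_norm_le (hcont m).aestronglyMeasurable (hb m)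
  simp only [h3] at h1
  have := tendsto_nhds_unique h1 h2.neg
  simpa using this

/-! ### The substitution `z = 1 / w` -/

lemma image_inv_compl_zero : (fun z : ℂ => z⁻¹) '' {0}ᶜ = {0}ᶜ := by
  ext z
  simp only [Set.mem_image, Set.mem_compl_iff, Set.mem_singleton_iff]
  exact ⟨fun ⟨x, hx, h⟩ => h ▸ inv_ne_zero hx, fun h => ⟨z⁻¹, inv_ne_zero h, inv_inv z⟩⟩

/-- The real determinant of multiplication by `c` is the algebra norm of `c` over `ℝ`. -/
lemma abs_det_toSpanSingleton (c : ℂ) :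
    |((ContinuousLinearMap.toSpanSingleton ℂ c).restrictScalars ℝ).det| = ‖c‖ ^ 2 := by
  have h : (((ContinuousLinearMap.toSpanSingleton ℂ c).restrictScalars ℝ : ℂ →L[ℝ] ℂ) :
      ℂ →ₗ[ℝ] ℂ) = Algebra.lmul ℝ ℂ c := by
    ext x
    simp [mul_comm x c]
  rw [ContinuousLinearMap.det, h, ← Algebra.norm_apply, Algebra.norm_complex_apply,
    abs_of_nonneg (Complex.normSq_nonneg _), Complex.normSq_eq_norm_sq]

lemma hasFDerivWithinAt_inv_real {z : ℂ} (hz : z ∈ ({0}ᶜ : Set ℂ)) :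
    HasFDerivWithinAt (fun z : ℂ => z⁻¹)
      ((ContinuousLinearMap.toSpanSingleton ℂ (-(z ^ 2)⁻¹)).restrictScalars ℝ) {0}ᶜ z :=
  ((hasDerivAt_inv hz).hasFDerivAt.restrictScalars ℝ).hasFDerivWithinAt

lemma restrict_compl_zero : (volume : Measure ℂ).restrict {0}ᶜ = volume :=
  Measure.restrict_eq_self_of_ae_mem (compl_mem_ae_iff.2 (measure_singleton 0))

/-- The Jacobian of `w ↦ w⁻¹` is `‖w⁻²‖ ^ 2`. The point `0`, where the inversion is not a chart, is
a null set. -/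
lemma integral_comp_inv (g : ℂ → ℂ) : ∫ z, g z = ∫ w, (‖w‖ ^ 4)⁻¹ • g w⁻¹ := by
  have h := integral_image_eq_integral_abs_det_fderiv_smul volume
    (measurableSet_singleton (0 : ℂ)).compl (fun z hz => hasFDerivWithinAt_inv_real hz)
    inv_injective.injOn g
  simp only [image_inv_compl_zero, restrict_compl_zero, abs_det_toSpanSingleton] at h
  rw [h]
  congr 1
  funext w
  simp [← pow_mul]

lemma integrable_comp_inv_iff (g : ℂ → ℂ) :
    Integrable g ↔ Integrable fun w => (‖w‖ ^ 4)⁻¹ • g w⁻¹ := by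
  have h := integrableOn_image_iff_integrableOn_abs_det_fderiv_smul volume
    (measurableSet_singleton (0 : ℂ)).compl (fun z hz => hasFDerivWithinAt_inv_real hz)
    inv_injective.injOn g
  simp only [image_inv_compl_zero, IntegrableOn, restrict_compl_zero,
    abs_det_toSpanSingleton] at h
  rw [h]
  simp [← pow_mul]

/-- Inversion trades the singularity for decay: the integrand becomes of size `‖w‖ ^ (-3)` on the
region `1 < R ‖w‖`, where `1 + ‖w‖ ≤ (1 + R) ‖w‖`. This explains the constant `(1 + R) ^ 3`. -/
lemma integrableOn_inv_ball (R : ℝ) : IntegrableOn (fun z : ℂ => z⁻¹) (Metric.ball 0 R) := by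
  have hms : MeasurableSet (Metric.ball (0 : ℂ) R) := measurableSet_ball
  rcases le_or_gt R 0 with hR | hR
  · rw [Metric.ball_eq_empty.2 hR]
    exact integrableOn_empty
  rw [← integrable_indicator_iff hms, integrable_comp_inv_iff]
  have hmeas : Measurable ((Metric.ball (0 : ℂ) R).indicator fun z => z⁻¹) :=
    measurable_inv.indicator hms
  refine integrable_of_norm_le (C := (1 + R) ^ 3)
    (((measurable_norm.pow_const 4).inv.smul (hmeas.comp measurable_inv)).aestronglyMeasurable)
    fun w => ?_
  have hp : (0 : ℝ) < 1 + ‖w‖ := by positivity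
  have hrp : (1 + ‖w‖) ^ (-3 : ℝ) = ((1 + ‖w‖) ^ 3)⁻¹ := by
    rw [Real.rpow_neg hp.le]
    norm_cast
  rw [hrp]
  by_cases hw : w⁻¹ ∈ Metric.ball (0 : ℂ) R
  · rw [Set.indicator_of_mem hw, inv_inv, norm_smul, norm_inv, norm_pow, norm_norm]
    -- Since `0⁻¹ = 0`, the point `w = 0` counts as mapped into the ball and has to be treated
    -- apart.
    rcases eq_or_ne w 0 with rfl | h0
    · simp; positivity
    have hw0 : 0 < ‖w‖ := norm_pos_iff.2 h0
    rw [mem_ball_zero_iff, norm_inv, inv_lt_iff_one_lt_mul₀ hw0] at hw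
    have h1 : (‖w‖ ^ 4)⁻¹ * ‖w‖ = (‖w‖ ^ 3)⁻¹ := by field_simp
    rw [h1, ← div_eq_mul_inv, le_div_iff₀ (by positivity), inv_mul_le_iff₀ (by positivity),
      ← mul_pow]
    gcongr
    nlinarith
  · rw [Set.indicator_of_notMem hw, smul_zero, norm_zero]
    positivity

lemma locallyIntegrable_inv : LocallyIntegrable fun z : ℂ => z⁻¹ := by
  rw [locallyIntegrable_iff]
  intro k hk
  obtain ⟨R, hR⟩ := hk.isBounded.subset_ball 0
  exact (integrableOn_inv_ball R).mono_set hR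

/-! ### The Cauchy–Pompeiu formula -/

lemma one_add_mul_conj (z : ℂ) : 1 + z * conj z = ((1 + ‖z‖ ^ 2 : ℝ) : ℂ) := by
  rw [Complex.mul_conj, Complex.normSq_eq_norm_sq]
  push_cast
  ring

lemma one_add_mul_conj_ne_zero (z : ℂ) : 1 + z * conj z ≠ 0 := by
  rw [one_add_mul_conj]
  exact_mod_cast (by positivity : (1 + ‖z‖ ^ 2 : ℝ) ≠ 0)

/-- The area `∫ (1 + |z|²)⁻²`. -/
noncomputable def fsArea : ℂ := ∫ z : ℂ, ((1 + z * conj z) ^ 2)⁻¹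

lemma norm_inv_sq_one_add_le (z : ℂ) :
    ‖((1 + z * conj z) ^ 2)⁻¹‖ ≤ 8 * (1 + ‖z‖) ^ (-3 : ℝ) := by
  have hp : (0 : ℝ) < 1 + ‖z‖ := by positivity
  have hrp : (1 + ‖z‖) ^ (-3 : ℝ) = ((1 + ‖z‖) ^ 3)⁻¹ := by
    rw [Real.rpow_neg hp.le]
    norm_cast
  rw [hrp, one_add_mul_conj, norm_inv, norm_pow, Complex.norm_real,
    Real.norm_of_nonneg (by positivity), ← div_eq_mul_inv, le_div_iff₀ (by positivity),
    inv_mul_le_iff₀ (by positivity)]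
  have h1 : (1 + ‖z‖) ^ 2 ≤ 2 * (1 + ‖z‖ ^ 2) := by nlinarith [sq_nonneg (1 - ‖z‖)]
  have h2 : 1 + ‖z‖ ≤ 2 * (1 + ‖z‖ ^ 2) := by nlinarith [sq_nonneg (1 - ‖z‖)]
  have h3 := mul_le_mul h1 h2 hp.le (by positivity)
  nlinarith [sq_nonneg (1 + ‖z‖ ^ 2)]

lemma continuous_inv_sq_one_add : Continuous fun z : ℂ => ((1 + z * conj z) ^ 2)⁻¹ := by
  refine Continuous.inv₀ ?_ fun z => pow_ne_zero _ (one_add_mul_conj_ne_zero z)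
  exact (continuous_const.add (continuous_id.mul Complex.continuous_conj)).pow 2

lemma integral_ofReal_ne_zero {f : ℂ → ℝ} (hf : ∀ z, 0 < f z) (hi : Integrable fun z => (f z : ℂ)) :
    ∫ z, (f z : ℂ) ≠ 0 := by
  rw [integral_complex_ofReal]
  have hi' : Integrable f := by
    simpa only [Complex.ofReal_re, Complex.reCLM_apply] using Complex.reCLM.integrable_comp hi
  have : 0 < ∫ z, f z := by
    refine (integral_pos_iff_support_of_nonneg (fun z => (hf z).le) hi').2 ?_
    have : Function.support f = Set.univ := eq_univ_of_forall fun z => (hf z).ne'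
    rw [this]
    exact isOpen_univ.measure_pos _ ⟨0, trivial⟩
  exact_mod_cast this.ne'

/-- The constant only normalises the Cauchy kernel, so that its actual value `π` plays no role. -/
lemma fsArea_ne_zero : fsArea ≠ 0 := by
  have h (z : ℂ) : ((1 + z * conj z) ^ 2)⁻¹ = ((((1 + ‖z‖ ^ 2) ^ 2)⁻¹ : ℝ) : ℂ) := by
    rw [one_add_mul_conj]
    push_cast
    rfl
  have hi := integrable_of_norm_le continuous_inv_sq_one_add.aestronglyMeasurable
    norm_inv_sq_one_add_le
  rw [fsArea]
  simp only [h] at hi ⊢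
  exact integral_ofReal_ne_zero (fun z => by positivity) hi

/-- The Cauchy–Pompeiu formula, for a function of compact support. -/
lemma integral_dbar_mul_inv {h : ℂ → ℂ} (hh : ContDiff ℝ ∞ h) (hc : HasCompactSupport h) :
    ∫ z, dbar h z * z⁻¹ = -(fsArea * h 0) := by
  set r : ℕ → ℝ := fun m => 1 / ((m : ℝ) + 1) with hr
  have hr0 (m : ℕ) : 0 < r m := by positivity
  have hrt : Tendsto r atTop (𝓝 0) := tendsto_one_div_add_atTop_nhds_zero_nat
  have hden (m : ℕ) (z : ℂ) : z * conj z + r m ^ 2 = ((‖z‖ ^ 2 + r m ^ 2 : ℝ) : ℂ) := by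
    rw [Complex.mul_conj, Complex.normSq_eq_norm_sq]
    push_cast
    ring
  have hden0 (m : ℕ) (z : ℂ) : z * conj z + (r m : ℂ) ^ 2 ≠ 0 := by
    rw [hden]
    have := hr0 m
    exact_mod_cast (by positivity : (‖z‖ ^ 2 + r m ^ 2 : ℝ) ≠ 0)
  -- A smooth regularisation of `1 / z`, dominated by `‖z⁻¹‖`. Its `∂/∂z̄` is `r² / (|z|² + r²)²`,
  -- an approximate identity of total mass `fsArea`, so that integrating by parts produces `h 0` in
  -- the limit.
  set K : ℕ → ℂ → ℂ := fun m z => conj z * (z * conj z + (r m : ℂ) ^ 2)⁻¹ with hK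
  have hconj : ContDiff ℝ ∞ fun z : ℂ => conj z := Complex.conjCLE.contDiff
  have hden_s (m : ℕ) : ContDiff ℝ ∞ fun z : ℂ => z * conj z + (r m : ℂ) ^ 2 :=
    (contDiff_id.mul hconj).add contDiff_const
  have hKs (m : ℕ) : ContDiff ℝ ∞ (K m) := hconj.mul ((hden_s m).inv (hden0 m))
  have hKd (m : ℕ) (z : ℂ) : dbar (K m) z = (r m : ℂ) ^ 2 * ((z * conj z + (r m : ℂ) ^ 2) ^ 2)⁻¹ := by
    have d1 : DifferentiableAt ℝ (fun z : ℂ => conj z) z := hconj.differentiable (by simp) z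
    have d2 : DifferentiableAt ℝ (fun z : ℂ => z * conj z + (r m : ℂ) ^ 2) z :=
      (hden_s m).differentiable (by simp) z
    have d3 : dbar (fun z : ℂ => z * conj z + (r m : ℂ) ^ 2) z = z := by
      have := dbar_add (f := fun z : ℂ => z * conj z) (g := fun _ => (r m : ℂ) ^ 2) (z := z)
        (differentiableAt_id.mul d1) (differentiableAt_const _)
      rw [dbar_holo_mul (f := fun z : ℂ => z) differentiableAt_id d1, dbar_conj,
        dbar_eq_zero (differentiableAt_const _)] at this
      rw [mul_one, add_zero] at this
      exact this
    have d4 : DifferentiableAt ℝ (fun z : ℂ => (z * conj z + (r m : ℂ) ^ 2)⁻¹) z :=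
      d2.inv (hden0 m z)
    rw [hK]
    simp only
    rw [dbar_mul d1 d4, dbar_conj, dbar_inv d2 (hden0 m z), d3]
    have := hden0 m z
    field_simp
    ring
  have hKn (m : ℕ) (z : ℂ) : ‖K m z‖ ≤ ‖z⁻¹‖ := by
    rcases eq_or_ne z 0 with rfl | hz
    · simp [hK]
    have hz' : 0 < ‖z‖ := norm_pos_iff.2 hz
    have := hr0 m
    rw [hK]
    simp only
    rw [hden, norm_mul, norm_inv, norm_inv, Complex.norm_real, Complex.norm_conj,
      Real.norm_of_nonneg (by positivity), ← div_eq_mul_inv, div_le_iff₀ (by positivity),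
      le_inv_mul_iff₀ hz']
    nlinarith
  have hdi : Integrable fun z => dbar h z * z⁻¹ :=
    locallyIntegrable_inv.integrable_smul_left_of_hasCompactSupport (continuous_dbar hh)
      (hasCompactSupport_dbar hc)
  have h1 : Tendsto (fun m => ∫ z, dbar h z * K m z) atTop (𝓝 (∫ z, dbar h z * z⁻¹)) := by
    refine tendsto_integral_of_dominated_convergence (fun z => ‖dbar h z * z⁻¹‖)
      (fun m => ((continuous_dbar hh).mul (hKs m).continuous).aestronglyMeasurable) hdi.norm
      (fun m => Eventually.of_forall fun z => ?_) ?_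
    · rw [norm_mul, norm_mul (dbar h z) z⁻¹]
      exact mul_le_mul_of_nonneg_left (hKn m z) (norm_nonneg _)
    · filter_upwards [compl_mem_ae_iff.2 (measure_singleton (0 : ℂ))] with z hz
      have hz : z ≠ 0 := hz
      have hz' : conj z ≠ 0 := by simpa using hz
      have : Tendsto (fun m => conj z * (z * conj z + (r m : ℂ) ^ 2)⁻¹) atTop
          (𝓝 (conj z * (z * conj z + ((0 : ℝ) : ℂ) ^ 2)⁻¹)) := by
        refine tendsto_const_nhds.mul ((tendsto_const_nhds.add
          (((Complex.continuous_ofReal.tendsto _).comp hrt).pow 2)).inv₀ ?_)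
        simp [hz]
      have e : conj z * (z * conj z + ((0 : ℝ) : ℂ) ^ 2)⁻¹ = z⁻¹ := by
        simp
        field_simp
      rw [e] at this
      exact tendsto_const_nhds.mul this
  have h2 : Tendsto (fun m => ∫ z, h (r m • z) * ((1 + z * conj z) ^ 2)⁻¹) atTop
      (𝓝 (∫ z : ℂ, h 0 * ((1 + z * conj z) ^ 2)⁻¹)) := by
    obtain ⟨C, hC⟩ := hh.continuous.bounded_above_of_compact_support hc
    have hC0 : 0 ≤ C := (norm_nonneg _).trans (hC 0)
    refine tendsto_integral_of_dominated_convergence (fun z => C * (8 * (1 + ‖z‖) ^ (-3 : ℝ)))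
      (fun m => ((hh.continuous.comp (continuous_const_smul _)).mul
        continuous_inv_sq_one_add).aestronglyMeasurable) ?_
      (fun m => Eventually.of_forall fun z => ?_) (Eventually.of_forall fun z => ?_)
    · exact ((integrable_one_add_norm
        (by rw [Complex.finrank_real_complex]; norm_num)).const_mul _).const_mul _
    · rw [norm_mul]
      exact mul_le_mul (hC _) (norm_inv_sq_one_add_le z) (norm_nonneg _) hC0
    · refine Tendsto.mul_const _ ?_
      have : Tendsto (fun m => r m • z) atTop (𝓝 ((0 : ℝ) • z)) := hrt.smul_const z
      rw [zero_smul] at this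
      exact (hh.continuous.tendsto 0).comp this
  have h3 (m : ℕ) : ∫ z, dbar h z * K m z = -∫ z, h (r m • z) * ((1 + z * conj z) ^ 2)⁻¹ := by
    have hs := integral_dbar_eq_zero_of_hasCompactSupport (hh.mul (hKs m)) hc.mul_right
    have e : dbar (fun z => h z * K m z) = fun z =>
        h z * ((r m : ℂ) ^ 2 * ((z * conj z + (r m : ℂ) ^ 2) ^ 2)⁻¹) + dbar h z * K m z := by
      funext z
      rw [dbar_mul (hh.differentiable (by simp) z) ((hKs m).differentiable (by simp) z), hKd]
      ring
    rw [e, integral_add] at hs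
    · rw [eq_neg_of_add_eq_zero_right hs]
      congr 1
      -- The substitution `z ↦ r z` turns the kernel `r² / (|z|² + r²)²` into `(1 + |z|²)⁻²`, and
      -- the dependence on `m` moves to the argument of `h`.
      have hsub := Measure.integral_comp_smul volume
        (fun z => h z * ((r m : ℂ) ^ 2 * ((z * conj z + (r m : ℂ) ^ 2) ^ 2)⁻¹)) (r m)
      have hrm := hr0 m
      rw [Complex.finrank_real_complex, abs_of_pos (by positivity), eq_comm,
        inv_smul_eq_iff₀ (by positivity)] at hsub
      rw [hsub, ← integral_smul]
      congr 1
      funext z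
      have hrc : (r m : ℂ) ≠ 0 := by exact_mod_cast hrm.ne'
      have e2 : (r m • z) * conj (r m • z) + (r m : ℂ) ^ 2 = (r m : ℂ) ^ 2 * (1 + z * conj z) := by
        simp only [Complex.real_smul, map_mul, Complex.conj_ofReal]
        ring
      have := one_add_mul_conj_ne_zero z
      rw [e2, Complex.real_smul]
      push_cast
      field_simp
    · refine Continuous.integrable_of_hasCompactSupport (hh.continuous.mul ?_) hc.mul_right
      exact continuous_const.mul (((hden_s m).continuous.pow 2).inv₀
        fun z => pow_ne_zero _ (hden0 m z))
    · exact ((continuous_dbar hh).mul (hKs m).continuous).integrable_of_hasCompactSupport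
        (hasCompactSupport_dbar hc).mul_right
  simp only [h3] at h1
  rw [tendsto_nhds_unique h1 h2.neg, integral_const_mul, fsArea, mul_comm]

/-! ### The Cauchy transform -/

/-- The Cauchy transform, an inverse of `∂/∂z̄` on decaying functions. -/
noncomputable def cauchyTransform (a : ℂ → ℂ) (p : ℂ) : ℂ :=
  fsArea⁻¹ * ∫ z, a z * (p - z)⁻¹

/-- Within distance `1` of `p`, boundedness of `a` meets the local integrability of the kernel.
Farther away the kernel is at most `1` and integrability of `a` suffices. -/
lemma integrable_mul_sub_inv {a : ℂ → ℂ} (ha : Integrable a) {C : ℝ} (hC : ∀ z, ‖a z‖ ≤ C) (p : ℂ) :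
    Integrable fun z => a z * (p - z)⁻¹ := by
  have hC0 : 0 ≤ C := (norm_nonneg _).trans (hC 0)
  have hk : Integrable ((Metric.ball (0 : ℂ) 1).indicator fun z => z⁻¹) :=
    (integrable_indicator_iff measurableSet_ball).2 (integrableOn_inv_ball 1)
  refine Integrable.mono' (((hk.comp_sub_left p).norm.const_mul C).add ha.norm)
    (ha.aestronglyMeasurable.mul (measurable_const.sub measurable_id).inv.aestronglyMeasurable)
    (Eventually.of_forall fun z => ?_)
  rw [norm_mul]
  simp only [Pi.add_apply]
  by_cases hz : p - z ∈ Metric.ball (0 : ℂ) 1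
  · rw [Set.indicator_of_mem hz]
    have := mul_le_mul_of_nonneg_right (hC z) (norm_nonneg (p - z)⁻¹)
    have := norm_nonneg (a z)
    linarith
  · rw [Set.indicator_of_notMem hz, norm_zero, mul_zero, zero_add]
    rw [mem_ball_zero_iff, not_lt] at hz
    refine mul_le_of_le_one_right (norm_nonneg _) ?_
    rw [norm_inv]
    exact inv_le_one_of_one_le₀ hz

/-- The transform is a convolution with `1 / z`, so derivatives fall on `a`. The Cauchy–Pompeiu
formula for `z ↦ a (p - z)` then evaluates the transform of `∂a/∂z̄`. -/
lemma cauchyTransform_of_hasCompactSupport {a : ℂ → ℂ} (ha : ContDiff ℝ ∞ a)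
    (hc : HasCompactSupport a) :
    ContDiff ℝ ∞ (cauchyTransform a) ∧ ∀ p, dbar (cauchyTransform a) p = a p := by
  have e : cauchyTransform a = fun p =>
      fsArea⁻¹ * convolution a (fun z : ℂ => z⁻¹) (ContinuousLinearMap.mul ℝ ℂ) volume p := by
    funext p
    simp [cauchyTransform, convolution_def]
  have hs : ContDiff ℝ ∞ (convolution a (fun z : ℂ => z⁻¹) (ContinuousLinearMap.mul ℝ ℂ) volume) :=
    hc.contDiff_convolution_left _ ha locallyIntegrable_inv
  refine ⟨e ▸ contDiff_const.mul hs, fun p => ?_⟩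
  rw [e, dbar_holo_mul (differentiableAt_const _) (hs.differentiable (by simp) p)]
  have hf := hc.hasFDerivAt_convolution_left (ContinuousLinearMap.mul ℝ ℂ) (ha.of_le (by simp))
    locallyIntegrable_inv p
  have hfd : Continuous (fderiv ℝ a) := ha.continuous_fderiv (by simp)
  have hv (v : ℂ) : fderiv ℝ (convolution a (fun z : ℂ => z⁻¹) (ContinuousLinearMap.mul ℝ ℂ) volume)
      p v = ∫ z, fderiv ℝ a z v * (p - z)⁻¹ := by
    have he := (hc.fderiv ℝ).convolutionExists_left
      ((ContinuousLinearMap.mul ℝ ℂ).precompL ℂ) hfd locallyIntegrable_inv p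
    rw [hf.fderiv, convolution_def, ContinuousLinearMap.integral_apply he]
    simp
  have hi (v : ℂ) : Integrable fun z => fderiv ℝ a z v * (p - z)⁻¹ := by
    have hcv : Continuous fun z => fderiv ℝ a z v := hfd.clm_apply continuous_const
    obtain ⟨C, hC⟩ := hcv.bounded_above_of_compact_support (hc.fderiv_apply ℝ v)
    exact integrable_mul_sub_inv (hcv.integrable_of_hasCompactSupport (hc.fderiv_apply ℝ v)) hC p
  have h1 : dbar (convolution a (fun z : ℂ => z⁻¹) (ContinuousLinearMap.mul ℝ ℂ) volume) p =
      ∫ z, dbar a z * (p - z)⁻¹ := by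
    simp only [dbar]
    rw [hv, hv, ← integral_const_mul, ← integral_add (hi 1) ((hi _).const_mul _), ← integral_div]
    congr 1
    funext z
    ring
  have hsub : ContDiff ℝ ∞ fun z => a (p - z) := ha.comp (contDiff_const.sub contDiff_id)
  have h2 := integral_dbar_mul_inv hsub (hc.comp_homeomorph (Homeomorph.subLeft p))
  have h3 (z : ℂ) : dbar (fun z => a (p - z)) z = -dbar a (p - z) := by
    have : HasFDerivAt (fun z => a (p - z)) ((fderiv ℝ a (p - z)).comp
        (-ContinuousLinearMap.id ℝ ℂ)) z :=
      (ha.differentiable (by simp) _).hasFDerivAt.comp z ((hasFDerivAt_id z).const_sub p)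
    simp only [dbar, this.fderiv]
    simp
    ring
  rw [h1, ← integral_sub_left_eq_self _ volume p]
  simp only [h3, sub_zero, neg_mul, sub_sub_cancel] at h2 ⊢
  rw [integral_neg, neg_inj] at h2
  rw [h2, inv_mul_cancel_left₀ fsArea_ne_zero]

/-- Off the support of the density the kernel is holomorphic in `q`. For `q` within `1 / 2` of `p`
it stays below `2` on the support, and its derivative below `4`, which allows differentiation under
the integral. -/
lemma differentiableAt_cauchyTransform {a : ℂ → ℂ} (ha : Integrable a) {p : ℂ}
    (h0 : ∀ z, ‖z - p‖ ≤ 1 → a z = 0) {q : ℂ} (hq : ‖q - p‖ < 1 / 2) :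
    DifferentiableAt ℂ (cauchyTransform a) q := by
  have hnorm (x z : ℂ) (hx : ‖x - p‖ < 1 / 2) : ‖a z‖ * ‖(x - z)⁻¹‖ ≤ 2 * ‖a z‖ ∧
      (a z ≠ 0 → x - z ≠ 0) := by
    by_cases hz : ‖z - p‖ ≤ 1
    · simp [h0 z hz]
    · rw [not_le] at hz
      have h1 : 1 / 2 ≤ ‖x - z‖ := by
        have := norm_sub_le (x - p) (x - z)
        rw [sub_sub_sub_cancel_left] at this
        linarith
      refine ⟨?_, fun _ => norm_pos_iff.1 (by linarith)⟩
      rw [mul_comm 2]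
      gcongr
      rw [norm_inv]
      exact inv_le_of_inv_le₀ two_pos (by linarith)
  have hmeas (x : ℂ) (m : ℕ) : AEStronglyMeasurable fun z => a z * ((x - z)⁻¹) ^ m :=
    ha.aestronglyMeasurable.mul
      (((measurable_const.sub measurable_id).inv).pow_const m).aestronglyMeasurable
  have hball : Metric.ball p (1 / 2) ∈ 𝓝 q :=
    Metric.isOpen_ball.mem_nhds (by rwa [Metric.mem_ball, dist_eq_norm])
  have key := hasDerivAt_integral_of_dominated_loc_of_deriv_le (μ := volume) (𝕜 := ℂ)
    (F := fun x z => a z * (x - z)⁻¹) (F' := fun x z => -(a z * ((x - z)⁻¹) ^ 2))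
    (bound := fun z => 4 * ‖a z‖) (x₀ := q) hball
    (Eventually.of_forall fun x => by simpa using hmeas x 1) ?_ (hmeas q 2).neg ?_
    (ha.norm.const_mul 4) ?_
  · exact (key.2.const_mul _).differentiableAt
  · refine Integrable.mono' (ha.norm.const_mul 2) (by simpa using hmeas q 1)
      (Eventually.of_forall fun z => ?_)
    rw [norm_mul]
    exact (hnorm q z hq).1
  · refine Eventually.of_forall fun z x hx => ?_
    rw [Metric.mem_ball, dist_eq_norm] at hx
    rw [norm_neg, norm_mul, norm_pow]
    have h1 := (hnorm x z hx).1
    have h2 := mul_le_mul_of_nonneg_right h1 (norm_nonneg (x - z)⁻¹)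
    nlinarith [norm_nonneg (a z), norm_nonneg (x - z)⁻¹]
  · refine Eventually.of_forall fun z x hx => ?_
    rw [Metric.mem_ball, dist_eq_norm] at hx
    rcases eq_or_ne (a z) 0 with h | h
    · simp only [h, zero_mul, neg_zero]
      exact hasDerivAt_const _ _
    · have hne := (hnorm x z hx).2 h
      have := (((hasDerivAt_id x).sub_const z).inv hne).const_mul (a z)
      refine this.congr_deriv ?_
      simp only [id]
      field_simp

/-- The Cauchy transform of an integrable bounded smooth function `a` solves `∂f/∂z̄ = a`. -/
lemma cauchyTransform_spec {a : ℂ → ℂ} (ha : ContDiff ℝ ∞ a) (hi : Integrable a) {C : ℝ}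
    (hC : ∀ z, ‖a z‖ ≤ C) :
    ContDiff ℝ ∞ (cauchyTransform a) ∧ ∀ p, dbar (cauchyTransform a) p = a p := by
  suffices h : ∀ p, ContDiffAt ℝ ∞ (cauchyTransform a) p ∧ dbar (cauchyTransform a) p = a p from
    ⟨contDiff_iff_contDiffAt.2 fun p => (h p).1, fun p => (h p).2⟩
  intro p
  -- Localisation at `p`: the part `χ a` has compact support, and the part `(1 - χ) a` vanishes
  -- within distance `1` of `p`, so its transform is holomorphic there and does not contribute to
  -- `∂/∂z̄` at `p`.
  set χ : ℂ → ℂ := fun z => dilatedCutoff 0 (z - p) with hχ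
  have hχs : ContDiff ℝ ∞ χ := (contDiff_dilatedCutoff 0).comp (contDiff_id.sub contDiff_const)
  have hχc : HasCompactSupport χ :=
    (hasCompactSupport_dilatedCutoff 0).comp_homeomorph (Homeomorph.subRight p)
  have hχ1 (z : ℂ) (hz : ‖z - p‖ ≤ 1) : χ z = 1 := dilatedCutoff_eq_one (by simpa using hz)
  have hχn (z : ℂ) : ‖χ z‖ ≤ 1 := norm_dilatedCutoff_le 0 _
  have hi1 : Integrable fun z => χ z * a z :=
    (hχs.mul ha).continuous.integrable_of_hasCompactSupport hχc.mul_right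
  have hi2 : Integrable fun z => (1 - χ z) * a z := by
    have := hi.sub hi1
    refine this.congr (Eventually.of_forall fun z => ?_)
    simp only [Pi.sub_apply, sub_mul, one_mul]
  have hb1 (z : ℂ) : ‖χ z * a z‖ ≤ C := by
    rw [norm_mul]
    exact (mul_le_of_le_one_left (norm_nonneg _) (hχn z)).trans (hC z)
  have hb2 (z : ℂ) : ‖(1 - χ z) * a z‖ ≤ C + C := by
    rw [sub_mul, one_mul]
    exact (norm_sub_le _ _).trans (add_le_add (hC z) (hb1 z))
  have hsplit : cauchyTransform a =
      cauchyTransform (fun z => χ z * a z) + cauchyTransform fun z => (1 - χ z) * a z := by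
    funext q
    simp only [cauchyTransform, Pi.add_apply]
    rw [← mul_add, ← integral_add (integrable_mul_sub_inv hi1 hb1 q)
      (integrable_mul_sub_inv hi2 hb2 q)]
    congr 2
    funext z
    ring
  obtain ⟨s1, s2⟩ := cauchyTransform_of_hasCompactSupport (hχs.mul ha) hχc.mul_right
  have hd (q : ℂ) (hq : ‖q - p‖ < 1 / 2) :
      DifferentiableAt ℂ (cauchyTransform fun z => (1 - χ z) * a z) q :=
    differentiableAt_cauchyTransform hi2 (fun z hz => by simp [hχ1 z hz]) hq
  have hp : ‖p - p‖ < 1 / 2 := by simp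
  have s3 : ContDiffAt ℝ ∞ (cauchyTransform fun z => (1 - χ z) * a z) p := by
    have : DifferentiableOn ℂ (cauchyTransform fun z => (1 - χ z) * a z) (Metric.ball p (1 / 2)) :=
      fun q hq => (hd q (by rwa [Metric.mem_ball, dist_eq_norm] at hq)).differentiableWithinAt
    exact ((this.analyticAt (Metric.ball_mem_nhds p (by norm_num))).contDiffAt).restrict_scalars ℝ
  rw [hsplit]
  refine ⟨s1.contDiffAt.add s3, ?_⟩
  rw [dbar_add (s1.differentiable (by simp) p) ((hd p hp).restrictScalars ℝ), s2,
    dbar_eq_zero (hd p hp), add_zero, hχ1 p (by simp), one_mul]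

/-! ### Sections of line bundles on the sphere -/

/-- Gluing determines the second coefficient for `w ≠ 0`, and continuity determines it at `w = 0`.
Identities between sections can thus be checked in the coordinate `z` alone. -/
lemma gluedSections_ext {τ : ℂ → ℂ} {s t : gluedSections τ} (h : s.1.1 = t.1.1) : s = t := by
  refine Subtype.ext (Prod.ext h ?_)
  refine Continuous.ext_on (dense_compl_singleton (0 : ℂ)) s.2.2.1.continuous t.2.2.1.continuous
    fun w hw => ?_
  rw [s.2.2.2 w hw, t.2.2.2 w hw, h]

lemma norm_Omega00 {d : ℤ} (s : Omega00 d) {z : ℂ} (hz : z ≠ 0) :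
    ‖s.1.1 z‖ = ‖z‖ ^ d * ‖s.1.2 z⁻¹‖ := by
  have hz' : ‖z‖ ≠ 0 := norm_ne_zero_iff.2 hz
  rw [s.2.2.2 _ (inv_ne_zero hz), inv_inv, norm_mul, norm_zpow, norm_inv, inv_zpow,
    mul_inv_cancel_left₀ (zpow_ne_zero _ hz')]

lemma norm_Omega01 {d : ℤ} (η : Omega01 d) {z : ℂ} (hz : z ≠ 0) :
    ‖η.1.1 z‖ = ‖z‖ ^ (d - 2) * ‖η.1.2 z⁻¹‖ := by
  have hz' : ‖z‖ ≠ 0 := norm_ne_zero_iff.2 hz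
  rw [η.2.2.2 _ (inv_ne_zero hz), inv_inv]
  simp only [norm_mul, norm_neg, norm_zpow, norm_inv, inv_zpow, norm_pow, Complex.norm_conj,
    inv_pow, inv_inv, zpow_sub₀ hz']
  norm_cast
  field_simp

/-- Both `f` and `g` are bounded on the closed unit disc, and the discs `‖z‖ ≤ 1`, `‖z⁻¹‖ ≤ 1` cover
the sphere. The factor `2 ^ q` comes from `1 + ‖z‖ ≤ 2` on one and `1 + ‖z‖ ≤ 2 ‖z‖` on the other.
-/
lemma exists_norm_le_of_inversion {f g : ℂ → ℂ} (hf : Continuous f) (hg : Continuous g) {e : ℤ}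
    {q : ℕ} (he : e ≤ -q) (h : ∀ z, z ≠ 0 → ‖f z‖ = ‖z‖ ^ e * ‖g z⁻¹‖) :
    ∃ C : ℝ, ∀ z, ‖f z‖ ≤ C * (1 + ‖z‖) ^ (-(q : ℝ)) := by
  obtain ⟨M, hM⟩ := (isCompact_closedBall (0 : ℂ) 1).exists_bound_of_continuousOn hf.continuousOn
  obtain ⟨N, hN⟩ := (isCompact_closedBall (0 : ℂ) 1).exists_bound_of_continuousOn hg.continuousOn
  have hM0 : 0 ≤ M := (norm_nonneg _).trans (hM 0 (by simp))
  have hN0 : 0 ≤ N := (norm_nonneg _).trans (hN 0 (by simp))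
  refine ⟨(M + N) * 2 ^ q, fun z => ?_⟩
  have hp : (0 : ℝ) < 1 + ‖z‖ := by positivity
  rw [Real.rpow_neg hp.le, Real.rpow_natCast, ← div_eq_mul_inv, le_div_iff₀ (by positivity)]
  rcases le_total ‖z‖ 1 with hz | hz
  · calc ‖f z‖ * (1 + ‖z‖) ^ q ≤ M * 2 ^ q := by
          gcongr
          · exact hM z (by simpa using hz)
          · linarith
      _ ≤ _ := by gcongr; linarith
  · have hz0 : z ≠ 0 := norm_pos_iff.1 (by linarith)
    have h1 : ‖z‖ ^ e ≤ (‖z‖ ^ q)⁻¹ := by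
      rw [← zpow_natCast, ← zpow_neg]
      exact zpow_le_zpow_right₀ hz he
    have h2 : ‖g z⁻¹‖ ≤ N := hN _ (by simpa using inv_le_one_of_one_le₀ hz)
    rw [h z hz0]
    calc ‖z‖ ^ e * ‖g z⁻¹‖ * (1 + ‖z‖) ^ q ≤ (‖z‖ ^ q)⁻¹ * N * (2 * ‖z‖) ^ q := by
          gcongr
          linarith
      _ = N * 2 ^ q := by
          have : ‖z‖ ≠ 0 := by positivity
          rw [mul_pow]
          field_simp
      _ ≤ _ := by gcongr; linarith

lemma exists_norm_pow_mul_Omega00_le {d : ℤ} (s : Omega00 d) {j : ℕ} {q : ℕ}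
    (h : j + d ≤ -q) : ∃ C : ℝ, ∀ z, ‖z ^ j * s.1.1 z‖ ≤ C * (1 + ‖z‖) ^ (-(q : ℝ)) := by
  refine exists_norm_le_of_inversion (f := fun z => z ^ j * s.1.1 z) (g := s.1.2) ((continuous_id.pow j).mul s.2.1.continuous)
    s.2.2.1.continuous h fun z hz => ?_
  rw [norm_mul, norm_Omega00 s hz, norm_pow, zpow_add₀ (norm_ne_zero_iff.2 hz), zpow_natCast,
    mul_assoc]

lemma exists_norm_pow_mul_Omega01_le {d : ℤ} (η : Omega01 d) {j : ℕ} {q : ℕ}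
    (h : j + d ≤ 2 - q) : ∃ C : ℝ, ∀ z, ‖z ^ j * η.1.1 z‖ ≤ C * (1 + ‖z‖) ^ (-(q : ℝ)) := by
  refine exists_norm_le_of_inversion (f := fun z => z ^ j * η.1.1 z) (g := η.1.2) (e := j + (d - 2))
    ((continuous_id.pow j).mul η.2.1.continuous)
    η.2.2.1.continuous (by omega) fun z hz => ?_
  rw [norm_mul, norm_Omega01 η hz, norm_pow, zpow_add₀ (norm_ne_zero_iff.2 hz), zpow_natCast,
    mul_assoc]

lemma integrable_pow_mul_Omega01 {d : ℤ} (η : Omega01 d) {j : ℕ} (h : j + d ≤ -1) :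
    Integrable fun z => z ^ j * η.1.1 z := by
  obtain ⟨C, hC⟩ := exists_norm_pow_mul_Omega01_le η (j := j) (q := 3) (by push_cast; omega)
  exact integrable_of_norm_le ((continuous_id.pow j).mul η.2.1.continuous).aestronglyMeasurable
    (by simpa using hC)

lemma exists_bound_pow_mul_Omega01 {d : ℤ} (η : Omega01 d) {j : ℕ} (h : j + d ≤ -1) :
    ∃ C : ℝ, ∀ z, ‖z ^ j * η.1.1 z‖ ≤ C := by
  obtain ⟨C, hC⟩ := exists_norm_pow_mul_Omega01_le η (j := j) (q := 0) (by push_cast; omega)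
  exact ⟨C, by simpa using hC⟩

lemma dbar_pow_mul {f : ℂ → ℂ} (hf : ContDiff ℝ ∞ f) (j : ℕ) (z : ℂ) :
    dbar (fun z => z ^ j * f z) z = z ^ j * dbar f z :=
  dbar_holo_mul (f := fun z => z ^ j) (differentiableAt_pow j) (hf.differentiable (by simp) z)

/-- The moments of a `D''`-exact form vanish. -/
lemma integral_pow_mul_dbar_eq_zero {d : ℤ} (s : Omega00 d) {j : ℕ} (h : j + d ≤ -2) :
    ∫ z, z ^ j * dbar s.1.1 z = 0 := by
  -- The condition `j + d ≤ -2` is exactly what gives `z ^ j s` the quadratic decay required by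
  -- Stokes' theorem.
  obtain ⟨C, hC⟩ := exists_norm_pow_mul_Omega00_le s (j := j) (q := 2) (by exact_mod_cast h)
  have hs : ContDiff ℝ ∞ fun z => z ^ j * s.1.1 z := (contDiff_id.pow j).mul s.2.1
  have := integral_dbar_eq_zero hs (C := C) (by simpa using hC) ?_
  · simpa only [dbar_pow_mul s.2.1] using this
  · have e : dbar (fun z => z ^ j * s.1.1 z) = fun z => z ^ j * (delbar d s).1.1 z :=
      funext fun z => dbar_pow_mul s.2.1 j z
    rw [e]
    exact integrable_pow_mul_Omega01 (delbar d s) (by omega)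

/-- Iterate `1 / (p - z) = p⁻¹ (1 + z / (p - z))`. Each step splits off one moment, which vanishes,
and gains one factor `p⁻¹`. There are `r` such steps, since `z ^ j η` is still integrable for `j ≤
r`. -/
lemma cauchyTransform_inv {d : ℤ} (η : Omega01 d) {r : ℕ} (hd : d = -((r : ℤ) + 1))
    (h0 : ∀ j < r, ∫ z, z ^ j * η.1.1 z = 0) {p : ℂ} (hp : p ≠ 0) :
    cauchyTransform η.1.1 p = fsArea⁻¹ * ((p ^ r)⁻¹ * ∫ z, z ^ r * η.1.1 z * (p - z)⁻¹) := by
  rw [cauchyTransform]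
  congr 1
  have hi (j : ℕ) (hj : j ≤ r) : Integrable fun z => z ^ j * η.1.1 z :=
    integrable_pow_mul_Omega01 η (by omega)
  have hi' (j : ℕ) (hj : j ≤ r) : Integrable fun z => z ^ j * η.1.1 z * (p - z)⁻¹ := by
    obtain ⟨C, hC⟩ := exists_bound_pow_mul_Omega01 η (j := j) (by omega)
    exact integrable_mul_sub_inv (hi j hj) hC p
  suffices h : ∀ j ≤ r, ∫ z, η.1.1 z * (p - z)⁻¹ =
      (p ^ j)⁻¹ * ∫ z, z ^ j * η.1.1 z * (p - z)⁻¹ from h r le_rfl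
  intro j
  induction j with
  | zero => simp
  | succ j ih =>
    intro hj
    rw [ih (by omega)]
    have e : (fun z => z ^ j * η.1.1 z * (p - z)⁻¹) =ᵐ[volume] fun z =>
        p⁻¹ * (z ^ j * η.1.1 z + z ^ (j + 1) * η.1.1 z * (p - z)⁻¹) := by
      filter_upwards [compl_mem_ae_iff.2 (measure_singleton p)] with z hz
      have hz : p - z ≠ 0 := sub_ne_zero.2 (Ne.symm hz)
      field_simp
      ring
    rw [integral_congr_ae e, integral_const_mul, integral_add (hi j (by omega)) (hi' _ hj),
      h0 j (by omega), zero_add, pow_succ]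
    field_simp

/-- A `(0,1)`-form with vanishing moments is `D''`-exact, with the Cauchy transforms of its
coefficients as a primitive. -/
lemma cauchyTransform_mem {d : ℤ} (η : Omega01 d) (hd : d < 0)
    (h0 : ∀ j : ℕ, j + d ≤ -2 → ∫ z, z ^ j * η.1.1 z = 0) :
    (cauchyTransform η.1.1, cauchyTransform η.1.2) ∈ Omega00 d ∧
      ∀ z, dbar (cauchyTransform η.1.1) z = η.1.1 z := by
  obtain ⟨r, hr⟩ : ∃ r : ℕ, d = -((r : ℤ) + 1) := ⟨(-d - 1).toNat, by omega⟩
  have hsw (w : ℂ) (hw : w ≠ 0) : η.1.1 w = -(conj w ^ 2)⁻¹ * w ^ d * η.1.2 w⁻¹ := by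
    have hw' : conj w ≠ 0 := by simpa using hw
    rw [η.2.2.2 _ (inv_ne_zero hw), inv_inv]
    simp only [map_inv₀, inv_pow, inv_inv, inv_zpow]
    have := zpow_ne_zero d hw
    field_simp
  -- Exchanging the roles of the two poles gives a form of the same type, so the transform of the
  -- coefficient at the north pole is smooth for the same reason.
  let η' : Omega01 d := ⟨(η.1.2, η.1.1), η.2.2.1, η.2.1, hsw⟩
  have hspec (θ : Omega01 d) : ContDiff ℝ ∞ (cauchyTransform θ.1.1) ∧
      ∀ p, dbar (cauchyTransform θ.1.1) p = θ.1.1 p := by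
    obtain ⟨C, hC⟩ := exists_bound_pow_mul_Omega01 θ (j := 0) (by push_cast; omega)
    have hi := integrable_pow_mul_Omega01 θ (j := 0) (by push_cast; omega)
    exact cauchyTransform_spec θ.2.1 (by simpa using hi) (C := C) (by simpa using hC)
  refine ⟨⟨(hspec η).1, (hspec η').1, fun w hw => ?_⟩, (hspec η).2⟩
  simp only
  rw [cauchyTransform_inv η hr (fun j hj => h0 j (by omega)) (inv_ne_zero hw), integral_comp_inv,
    cauchyTransform]
  -- After `z = 1 / v` the integrand is `w` times the one of the transform at the north pole.
  -- Together with the `w ^ r` gained from the moments this cancels the transition function `w ^ d`,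
  -- since `d = -(r + 1)`.
  have e : (fun v : ℂ => (‖v‖ ^ 4)⁻¹ • (v⁻¹ ^ r * η.1.1 v⁻¹ * (w⁻¹ - v⁻¹)⁻¹)) =ᵐ[volume]
      fun v => w * (η.1.2 v * (w - v)⁻¹) := by
    filter_upwards [compl_mem_ae_iff.2 (measure_singleton (0 : ℂ)),
      compl_mem_ae_iff.2 (measure_singleton w)] with v hv hvw
    have hv : v ≠ 0 := hv
    have hvw : w - v ≠ 0 := sub_ne_zero.2 (Ne.symm hvw)
    have hv' : conj v ≠ 0 := by simpa using hv
    have hn : ((‖v‖ ^ 4 : ℝ) : ℂ) = v ^ 2 * conj v ^ 2 := by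
      rw [← mul_pow, Complex.mul_conj, Complex.normSq_eq_norm_sq]
      push_cast
      ring
    have h3 : w⁻¹ - v⁻¹ = -(w - v) * (w⁻¹ * v⁻¹) := by
      field_simp
      ring
    have hd' : v ^ d = (v ^ (r + 1))⁻¹ := by
      rw [hr, zpow_neg]
      norm_cast
    rw [Complex.real_smul, Complex.ofReal_inv, hn, η.2.2.2 v hv, h3]
    simp only [hd', inv_pow, pow_succ v r]
    field_simp
  rw [integral_congr_ae e, integral_const_mul]
  have hd' : w ^ d = (w ^ (r + 1))⁻¹ := by
    rw [hr, zpow_neg]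
    norm_cast
  rw [hd', inv_pow, inv_inv, pow_succ]
  field_simp

lemma mem_range_delbar {d : ℤ} (η : Omega01 d) (hd : d < 0)
    (h0 : ∀ j : ℕ, j + d ≤ -2 → ∫ z, z ^ j * η.1.1 z = 0) :
    η ∈ LinearMap.range (delbar d) := by
  obtain ⟨h1, h2⟩ := cauchyTransform_mem η hd h0
  exact ⟨⟨_, h1⟩, gluedSections_ext (funext h2)⟩

/-! ### Holomorphic sections -/

/-- Near infinity `f z = z⁻¹ ^ (-d) * g z⁻¹` tends to `0`, because `g` is bounded near `0`;
Liouville's theorem concludes. -/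
lemma eq_zero_of_holomorphic_of_neg {f g : ℂ → ℂ} (hf : Differentiable ℂ f) (hg : Continuous g)
    {d : ℤ} (hd : d < 0) (h : ∀ w, w ≠ 0 → g w = w ^ d * f w⁻¹) (z : ℂ) : f z = 0 := by
  obtain ⟨r, hr⟩ : ∃ r : ℕ, d = -((r : ℤ) + 1) := ⟨(-d - 1).toNat, by omega⟩
  refine hf.apply_eq_of_tendsto_cocompact z ?_
  have h1 : Tendsto (fun w => w ^ (r + 1) * g w) (𝓝[≠] 0) (𝓝 0) := by
    have : Tendsto (fun w => w ^ (r + 1) * g w) (𝓝 0) (𝓝 (0 ^ (r + 1) * g 0)) :=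
      ((continuous_pow (r + 1)).mul hg).tendsto 0
    rw [zero_pow r.succ_ne_zero, zero_mul] at this
    exact this.mono_left nhdsWithin_le_nhds
  have h2 := h1.comp (Filter.tendsto_inv₀_cobounded' (α := ℂ))
  rw [Metric.cobounded_eq_cocompact] at h2
  refine h2.congr' ?_
  have : ∀ᶠ z : ℂ in cocompact ℂ, z ≠ 0 := by
    have : ({0}ᶜ : Set ℂ) ∈ cocompact ℂ := isCompact_singleton.compl_mem_cocompact
    exact this
  filter_upwards [this] with z hz
  have hd' : z⁻¹ ^ d = z ^ (r + 1) := by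
    rw [hr, inv_zpow, zpow_neg, inv_inv]
    norm_cast
  simp only [Function.comp_apply]
  rw [h _ (inv_ne_zero hz), inv_inv, hd', ← mul_assoc, ← mul_pow, inv_mul_cancel₀ hz, one_pow,
    one_mul]

/-- A holomorphic section of the line bundle of degree `n` is a polynomial of degree at most `n`. -/
lemma exists_eq_sum_of_holomorphic (n : ℕ) {f g : ℂ → ℂ} (hf : Differentiable ℂ f)
    (hg : Continuous g) (h : ∀ w, w ≠ 0 → g w = w ^ (n : ℤ) * f w⁻¹) :
    ∃ c : ℕ → ℂ, ∀ z, f z = ∑ j ∈ Finset.range (n + 1), c j * z ^ j := by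
  -- The quotient `(f z - f 0) / z` is a holomorphic section for the degree one lower. At degree `0`
  -- this lands in degree `-1`, where only zero is left.
  induction n generalizing f g with
  | zero =>
    refine ⟨fun _ => f 0, fun z => ?_⟩
    have hd : Differentiable ℂ (dslope f 0) := fun z =>
      (Complex.differentiableOn_dslope univ_mem).2 hf.differentiableOn z (mem_univ z)
        |>.differentiableAt univ_mem
    have hz := eq_zero_of_holomorphic_of_neg (g := fun w => g w - f 0) (d := -1) hd
      (hg.sub continuous_const) (by norm_num) (fun w hw => by
        simp only [h w hw, dslope_of_ne f (inv_ne_zero hw), slope_def_field]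
        simp
        field_simp) z
    have := sub_smul_dslope f 0 z
    rw [hz, smul_zero, eq_comm, sub_eq_zero] at this
    simp [this]
  | succ n ih =>
    have hd : Differentiable ℂ (dslope f 0) := fun z =>
      (Complex.differentiableOn_dslope univ_mem).2 hf.differentiableOn z (mem_univ z)
        |>.differentiableAt univ_mem
    obtain ⟨c, hc⟩ := ih (g := fun w => g w - f 0 * w ^ (n + 1)) hd
      (hg.sub (continuous_const.mul (continuous_pow _))) (fun w hw => by
        simp only [h w hw, dslope_of_ne f (inv_ne_zero hw), slope_def_field, zpow_natCast, pow_succ]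
        field_simp
        simp)
    refine ⟨fun j => Nat.casesOn j (f 0) c, fun z => ?_⟩
    have := sub_smul_dslope f 0 z
    rw [hc, sub_zero, smul_eq_mul] at this
    rw [Finset.sum_range_succ', eq_add_of_sub_eq this.symm, Finset.mul_sum]
    simp only [pow_zero, mul_one]
    congr 1
    refine Finset.sum_congr rfl fun j _ => ?_
    ring

lemma differentiable_of_dbar_eq_zero {f : ℂ → ℂ} (hf : ContDiff ℝ ∞ f) (h : ∀ z, dbar f z = 0) :
    Differentiable ℂ f := fun z => (dbar_eq_zero_iff (hf.differentiable (by simp) z)).1 (h z)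

/-! ### The Gram matrix of the monomials -/

/-- The function `z ^ j * z̄ ^ i * (1 + |z|²) ^ (-m)`. -/
noncomputable def gramFun (m i j : ℕ) (z : ℂ) : ℂ := z ^ j * (conj z ^ i * ((1 + z * conj z) ^ m)⁻¹)

lemma contDiff_inv_one_add_pow (m : ℕ) : ContDiff ℝ ∞ fun z : ℂ => ((1 + z * conj z) ^ m)⁻¹ := by
  simpa only [zpow_neg, zpow_natCast] using contDiff_one_add_normSq_zpow (-m)

lemma contDiff_gramFun (m i j : ℕ) : ContDiff ℝ ∞ (gramFun m i j) :=
  (contDiff_id.pow j).mul ((Complex.conjCLE.contDiff.pow i).mul (contDiff_inv_one_add_pow m))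

lemma exists_norm_gramFun_le {m i j q : ℕ} (h : i + j + q ≤ 2 * m) :
    ∃ C : ℝ, ∀ z, ‖gramFun m i j z‖ ≤ C * (1 + ‖z‖) ^ (-(q : ℝ)) := by
  refine exists_norm_le_of_inversion (f := gramFun m i j) (e := (i + j : ℕ) - (2 * m : ℕ))
    (contDiff_gramFun m i j).continuous (contDiff_inv_one_add_pow m).continuous (by omega)
    fun z hz => ?_
  have hz' : ‖z‖ ≠ 0 := norm_ne_zero_iff.2 hz
  simp only [gramFun, one_add_mul_conj, norm_mul, norm_inv, norm_pow, Complex.norm_conj,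
    Complex.norm_real]
  rw [Real.norm_of_nonneg (by positivity), Real.norm_of_nonneg (by positivity), zpow_sub₀ hz',
    zpow_natCast, zpow_natCast]
  have : 1 + ‖z‖⁻¹ ^ 2 = (1 + ‖z‖ ^ 2) * (‖z‖ ^ 2)⁻¹ := by
    field_simp
    ring
  rw [this, mul_pow, pow_mul, pow_add, inv_pow]
  have : (1 + ‖z‖ ^ 2) ≠ 0 := by positivity
  field_simp

lemma integrable_gramFun {m i j : ℕ} (h : i + j + 3 ≤ 2 * m) : Integrable (gramFun m i j) := by
  obtain ⟨C, hC⟩ := exists_norm_gramFun_le h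
  exact integrable_of_norm_le (contDiff_gramFun m i j).continuous.aestronglyMeasurable
    (by simpa using hC)

/-- The rotation by the angle `π / (j - i)` preserves area and multiplies the integrand by `-1`. -/
lemma integral_gramFun_of_ne (m : ℕ) {i j : ℕ} (h : i ≠ j) : ∫ z, gramFun m i j z = 0 := by
  set θ : ℝ := Real.pi / ((j : ℝ) - i) with hθ
  have hji : ((j : ℝ) - i) ≠ 0 := sub_ne_zero.2 (by exact_mod_cast h.symm)
  set u : Circle := Circle.exp θ with hu
  have hu1 : (u : ℂ) * conj (u : ℂ) = 1 := by
    rw [Complex.mul_conj, Complex.normSq_eq_norm_sq, Circle.norm_coe]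
    simp
  have hcoef : (u : ℂ) ^ j * conj (u : ℂ) ^ i = -1 := by
    rw [hu, Circle.coe_exp, ← Complex.exp_conj, ← Complex.exp_nat_mul, ← Complex.exp_nat_mul,
      ← Complex.exp_add, ← Complex.exp_pi_mul_I]
    congr 1
    simp only [map_mul, Complex.conj_ofReal, Complex.conj_I]
    have : (θ : ℂ) * ((j : ℂ) - i) = Real.pi := by
      rw [hθ]
      push_cast
      exact div_mul_cancel₀ _ (by exact_mod_cast hji)
    linear_combination Complex.I * this
  have h1 := (rotation u).measurePreserving.integral_comp
    (rotation u).toHomeomorph.measurableEmbedding (gramFun m i j)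
  have h2 (z : ℂ) : gramFun m i j (rotation u z) = -gramFun m i j z := by
    have : (u : ℂ) * z * (conj (u : ℂ) * conj z) = z * conj z := by
      linear_combination (z * conj z) * hu1
    simp only [gramFun, rotation_apply, map_mul, this, mul_pow]
    linear_combination (z ^ j * conj z ^ i * ((1 + z * conj z) ^ m)⁻¹) * hcoef
  simp only [h2, integral_neg] at h1
  exact self_eq_neg.1 h1.symm

lemma dbar_gramFun (n j : ℕ) (z : ℂ) : dbar (gramFun (n + 1) (j + 1) j) z =
    (j + 1) * gramFun (n + 2) j j z - ((n : ℂ) - j) * gramFun (n + 2) (j + 1) (j + 1) z := by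
  have d1 : DifferentiableAt ℝ (fun z : ℂ => conj z) z := Complex.conjCLE.differentiableAt
  have d2 : DifferentiableAt ℝ (fun z : ℂ => z * conj z) z := differentiableAt_id.mul d1
  have d3 : DifferentiableAt ℝ (fun z : ℂ => 1 + z * conj z) z := d2.const_add 1
  have d4 : DifferentiableAt ℝ (fun z : ℂ => (1 + z * conj z) ^ (n + 1)) z := d3.pow (n + 1)
  have hne := one_add_mul_conj_ne_zero z
  have d5 : DifferentiableAt ℝ (fun z : ℂ => ((1 + z * conj z) ^ (n + 1))⁻¹) z :=
    d4.inv (pow_ne_zero _ hne)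
  have d6 : DifferentiableAt ℝ (fun z : ℂ => conj z ^ (j + 1)) z := d1.pow (j + 1)
  have e1 : dbar (fun z : ℂ => 1 + z * conj z) z = z := by
    have := dbar_add (f := fun _ => (1 : ℂ)) (differentiableAt_const _) d2
    rw [dbar_holo_mul (f := fun z : ℂ => z) differentiableAt_id d1, dbar_conj,
      dbar_eq_zero (differentiableAt_const _), mul_one, zero_add] at this
    exact this
  change dbar (fun z => z ^ j * (conj z ^ (j + 1) * ((1 + z * conj z) ^ (n + 1))⁻¹)) z = _
  have d7 : DifferentiableAt ℝ
      (fun z : ℂ => conj z ^ (j + 1) * ((1 + z * conj z) ^ (n + 1))⁻¹) z := d6.mul d5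
  rw [dbar_holo_mul (f := fun z => z ^ j) (differentiableAt_pow j) d7, dbar_mul d6 d5,
    dbar_inv d4 (pow_ne_zero _ hne), dbar_pow d3, dbar_pow d1, e1, dbar_conj]
  simp only [gramFun]
  field_simp
  ring

/-- Stokes' theorem for the function in `dbar_gramFun`, which is chosen so that its `∂/∂z̄` combines
two consecutive diagonal integrands. The hypothesis `j < n` provides the decay. -/
lemma integral_gramFun_succ {n j : ℕ} (h : j < n) :
    ((n : ℂ) - j) * ∫ z, gramFun (n + 2) (j + 1) (j + 1) z =
      (j + 1) * ∫ z, gramFun (n + 2) j j z := by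
  obtain ⟨C, hC⟩ := exists_norm_gramFun_le (m := n + 1) (i := j + 1) (j := j) (q := 2) (by omega)
  have i1 := (integrable_gramFun (m := n + 2) (i := j) (j := j) (by omega)).const_mul ((j : ℂ) + 1)
  have i2 := (integrable_gramFun (m := n + 2) (i := j + 1) (j := j + 1) (by omega)).const_mul
    ((n : ℂ) - j)
  have hs := integral_dbar_eq_zero (contDiff_gramFun (n + 1) (j + 1) j) (C := C)
    (by simpa using hC) (by
      have := i1.sub i2
      exact this.congr (Eventually.of_forall fun z => (dbar_gramFun n j z).symm))
  simp only [dbar_gramFun] at hs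
  rw [integral_sub i1 i2, integral_const_mul, integral_const_mul] at hs
  linear_combination -hs

/-- The total mass `∫ (1 + |z|²) ^ (-(n + 2))`. -/
noncomputable def gramMass (n : ℕ) : ℂ := ∫ z, gramFun (n + 2) 0 0 z

lemma gramMass_ne_zero (n : ℕ) : gramMass n ≠ 0 := by
  have h (z : ℂ) : gramFun (n + 2) 0 0 z = ((((1 + ‖z‖ ^ 2) ^ (n + 2))⁻¹ : ℝ) : ℂ) := by
    rw [gramFun, one_add_mul_conj]
    push_cast
    ring
  have hi := integrable_gramFun (m := n + 2) (i := 0) (j := 0) (by omega)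
  rw [gramMass]
  simp only [h] at hi ⊢
  exact integral_ofReal_ne_zero (fun z => by positivity) (hi.congr (Eventually.of_forall h))

/-- The recursion for the diagonal integrals is the one satisfied by `1 / n.choose j`, by `(j + 1) *
n.choose (j + 1) = (n - j) * n.choose j`. -/
lemma choose_mul_integral_gramFun {n j : ℕ} (h : j ≤ n) :
    (n.choose j : ℂ) * ∫ z, gramFun (n + 2) j j z = gramMass n := by
  induction j with
  | zero => simp [gramMass]
  | succ j ih =>
    rw [← ih (by omega)]
    have h1 : (n.choose (j + 1) : ℂ) * (j + 1) = n.choose j * ((n : ℂ) - j) := by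
      have := Nat.choose_succ_right_eq n j
      rw [← Nat.cast_sub (by omega)]
      exact_mod_cast this
    have h2 : ((j : ℂ) + 1) ≠ 0 := by exact_mod_cast j.succ_ne_zero
    refine mul_left_cancel₀ h2 ?_
    linear_combination (∫ z, gramFun (n + 2) (j + 1) (j + 1) z) * h1 +
      (n.choose j : ℂ) * integral_gramFun_succ (n := n) (j := j) (by omega)

/-! ### Linear coordinates on `ℋ^{0,1}(L*)` -/

section Coordinates

variable {d : ℤ} {n : ℕ}

/-- The coefficient of the `H₀`-dual of a section given by a polynomial has moments given by the
coefficients of the polynomial. -/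
lemma choose_mul_integral_dualH0 (hd : d = n + 2) (φ : Omega10 d) (c : ℕ → ℂ)
    (hc : ∀ z, φ.1.1 z = ∑ i ∈ Finset.range (n + 1), c i * z ^ i) {j : ℕ} (hj : j ≤ n) :
    (n.choose j : ℂ) * ∫ z, z ^ j * (dualH0 φ).1.1 z = gramMass n * conj (c j) := by
  have e (z : ℂ) : z ^ j * (dualH0 φ).1.1 z =
      ∑ i ∈ Finset.range (n + 1), conj (c i) * gramFun (n + 2) i j z := by
    change z ^ j * (conj (φ.1.1 z) * (1 + z * conj z) ^ (-d)) = _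
    have hz : (1 + z * conj z) ^ (-d) = ((1 + z * conj z) ^ (n + 2))⁻¹ := by
      rw [hd, zpow_neg]
      norm_cast
    rw [hc, hz, map_sum, Finset.sum_mul, Finset.mul_sum]
    refine Finset.sum_congr rfl fun i _ => ?_
    simp only [gramFun, map_mul, map_pow]
    ring
  simp only [e]
  rw [integral_finsetSum]
  · rw [Finset.sum_eq_single j]
    · rw [integral_const_mul, mul_left_comm, choose_mul_integral_gramFun hj, mul_comm]
    · intro i _ hij
      rw [integral_const_mul, integral_gramFun_of_ne _ hij, mul_zero]
    · intro h
      exact absurd (Finset.mem_range.2 (by omega)) h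
  · intro i hi
    have := Finset.mem_range.1 hi
    exact (integrable_gramFun (by omega)).const_mul _

/-- The moments of a `(0,1)`-form with values in `L*`. -/
noncomputable def momentMap (hd : d = n + 2) : Omega01 (-d) →ₗ[ℂ] (Fin (n + 1) → ℂ) where
  -- The factor `2` is that of `i dz ∧ dz̄ = 2 dx dy` in `coupling`.
  toFun η j := 2 * ∫ z, z ^ (j : ℕ) * η.1.1 z
  map_add' η θ := by
    funext j
    have hj := j.2
    have h : (fun z => z ^ (j : ℕ) * (η + θ).1.1 z) = fun z =>
        z ^ (j : ℕ) * η.1.1 z + z ^ (j : ℕ) * θ.1.1 z := funext fun z => mul_add _ _ _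
    rw [h, integral_add (integrable_pow_mul_Omega01 η (by omega))
      (integrable_pow_mul_Omega01 θ (by omega)), mul_add]
    rfl
  map_smul' c η := by
    funext j
    have h : (fun z => z ^ (j : ℕ) * (c • η).1.1 z) = fun z => c * (z ^ (j : ℕ) * η.1.1 z) :=
      funext fun z => mul_left_comm _ _ _
    rw [h, integral_const_mul, mul_left_comm]
    rfl

lemma momentMap_apply (hd : d = n + 2) (η : Omega01 (-d)) (j : Fin (n + 1)) :
    momentMap hd η j = 2 * ∫ z, z ^ (j : ℕ) * η.1.1 z := rfl

/-- For forms of degree `-d = -(n + 2)`, the range `j ≤ n` is exactly `j + (-d) ≤ -2`. This is where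
Stokes' theorem kills the moments of exact forms, and these are all the moments needed to build a
primitive. -/
lemma ker_momentMap (hd : d = n + 2) :
    LinearMap.ker (momentMap hd) = LinearMap.range (delbar (-d)) := by
  ext η
  rw [LinearMap.mem_ker]
  constructor
  · intro h
    refine mem_range_delbar η (by omega) fun j hj => ?_
    have := congrFun h ⟨j, by omega⟩
    simpa [momentMap_apply] using this
  · rintro ⟨s, rfl⟩
    funext j
    have hj := j.2
    have := integral_pow_mul_dbar_eq_zero s (j := j) (by omega)
    rw [momentMap_apply]
    change 2 * ∫ z, z ^ (j : ℕ) * dbar s.1.1 z = 0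
    rw [this, mul_zero]

lemma monomialSection_mem_H10 {j : ℕ} (hj : (j : ℤ) ≤ d - 2) : monomialSection d j hj ∈ H10 d :=
  ⟨fun _ => dbar_eq_zero (f := fun z => z ^ j) (differentiableAt_pow j),
    fun _ => dbar_eq_zero (f := fun w => -w ^ (d - 2 - j).toNat) (differentiableAt_pow _).neg⟩

/-- The holomorphic section with coefficient the polynomial `∑ c j z ^ j`. -/
noncomputable def polySection (hd : d = n + 2) (c : Fin (n + 1) → ℂ) : H10 d :=
  ∑ j : Fin (n + 1), c j • ⟨monomialSection d j (by have := j.2; omega), monomialSection_mem_H10 _⟩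

lemma polySection_apply (hd : d = n + 2) (c : ℕ → ℂ) (z : ℂ) :
    (polySection hd fun j => c j).1.1.1 z = ∑ i ∈ Finset.range (n + 1), c i * z ^ i := by
  rw [Finset.sum_range]
  simp only [polySection, AddSubmonoidClass.coe_finsetSum, Prod.fst_sum, Finset.sum_apply]
  rfl

/-- As `T^{1,0}` has degree `-2`, these forms are holomorphic sections for the degree `n`. The sign
in `g` absorbs that of `dz = -w⁻² dw`. -/
lemma exists_coeff (hd : d = n + 2) (φ : H10 d) :
    ∃ c : ℕ → ℂ, ∀ z, φ.1.1.1 z = ∑ i ∈ Finset.range (n + 1), c i * z ^ i := by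
  refine exists_eq_sum_of_holomorphic n (g := fun w => -φ.1.1.2 w)
    (differentiable_of_dbar_eq_zero φ.1.2.1 φ.2.1) φ.1.2.2.1.continuous.neg fun w hw => ?_
  have e : w ^ d = w ^ (n : ℤ) * w ^ 2 := by
    rw [hd, zpow_add₀ hw]
    norm_cast
  rw [φ.1.2.2.2 w hw]
  simp only [e]
  field_simp

lemma choose_ne_zero {j : ℕ} (hj : j ≤ n) : (n.choose j : ℂ) ≠ 0 := by
  exact_mod_cast (Nat.choose_pos hj).ne'

lemma momentMap_dualH0 (hd : d = n + 2) (φ : Omega10 d) (c : ℕ → ℂ)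
    (hc : ∀ z, φ.1.1 z = ∑ i ∈ Finset.range (n + 1), c i * z ^ i) (j : Fin (n + 1)) :
    (n.choose j : ℂ) * momentMap hd (dualH0 φ) j = 2 * gramMass n * conj (c j) := by
  have := choose_mul_integral_dualH0 hd φ c hc (j := j) (by omega)
  rw [momentMap_apply]
  linear_combination 2 * this

/-- The relation `momentMap_dualH0` between coefficients and moments is diagonal with nonzero
entries; the witness `c` solves it. Conjugations appear because the `H₀`-dual is antilinear. The
values of `c` beyond `n` are irrelevant. -/
lemma exists_momentMap_dualH0_eq (hd : d = n + 2) (x : Fin (n + 1) → ℂ) :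
    ∃ φ : H10 d, momentMap hd (dualH0 φ.1) = x := by
  let c : ℕ → ℂ := fun j => if h : j < n + 1 then
    conj ((n.choose j : ℂ) * x ⟨j, h⟩ / (2 * gramMass n)) else 0
  refine ⟨polySection hd fun j => c j, funext fun j => ?_⟩
  have := momentMap_dualH0 hd _ c (polySection_apply hd c) j
  refine mul_left_cancel₀ (choose_ne_zero (Nat.lt_succ_iff.1 j.2)) (this.trans ?_)
  have hm := gramMass_ne_zero n
  simp only [c, j.2, dif_pos, Complex.conj_conj]
  field_simp

/-- The linear coordinates on `ℋ^{0,1}(L*)` given by the moments. -/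
noncomputable def coordEquiv (hd : d = n + 2) : H01 (-d) ≃ₗ[ℂ] (Fin (n + 1) → ℂ) :=
  (Submodule.quotEquivOfEq _ _ (ker_momentMap hd).symm).trans
    ((momentMap hd).quotKerEquivOfSurjective fun x =>
      let ⟨_, hφ⟩ := exists_momentMap_dualH0_eq hd x
      ⟨_, hφ⟩)

lemma coordEquiv_cls (hd : d = n + 2) (η : Omega01 (-d)) :
    coordEquiv hd (cls η) = momentMap hd η := rfl

/-- In coefficients and coordinates the map is conjugation followed by an invertible diagonal
matrix. Being only antilinear, it is compared on two sections instead of through a kernel. -/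
lemma bijective_cls_dualH0 (hd : d = n + 2) :
    Function.Bijective fun φ : H10 d => cls (dualH0 φ.1) := by
  constructor
  · intro φ ψ h
    obtain ⟨c, hc⟩ := exists_coeff hd φ
    obtain ⟨e, he⟩ := exists_coeff hd ψ
    have h' : momentMap hd (dualH0 φ.1) = momentMap hd (dualH0 ψ.1) := by
      simpa only [coordEquiv_cls] using congrArg (coordEquiv hd) h
    refine Subtype.ext (gluedSections_ext (funext fun z => ?_))
    rw [hc, he]
    refine Finset.sum_congr rfl fun i hi => ?_
    have h1 := momentMap_dualH0 hd φ.1 c hc ⟨i, Finset.mem_range.1 hi⟩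
    rw [h', momentMap_dualH0 hd ψ.1 e he ⟨i, Finset.mem_range.1 hi⟩] at h1
    have h2 := mul_left_cancel₀ (mul_ne_zero two_ne_zero (gramMass_ne_zero n)) h1
    rw [(starRingEnd ℂ).injective h2]
  · intro x
    obtain ⟨φ, hφ⟩ := exists_momentMap_dualH0_eq hd (coordEquiv hd x)
    exact ⟨φ, (coordEquiv hd).injective (by rw [coordEquiv_cls, hφ])⟩

/-! ### The divisor of a power of a linear form -/

lemma meromorphicOrderAt_linear_pow {A α β : ℂ} (hA : A ≠ 0) (n : ℕ) (z₀ : ℂ) {f : ℂ → ℂ}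
    (hf : ∀ z, f z = A * (α + β * z) ^ n) (h : α ≠ 0 ∨ β ≠ 0) :
    meromorphicOrderAt f z₀ = ((if α + β * z₀ = 0 then (n : ℤ) else 0 : ℤ) : WithTop ℤ) := by
  have han : AnalyticAt ℂ f z₀ := by
    rw [funext hf]
    fun_prop
  rw [meromorphicOrderAt_eq_int_iff han.meromorphicAt]
  split_ifs with h0
  · have hβ : β ≠ 0 := by
      rintro rfl
      simp at h0 h
      exact h h0
    refine ⟨fun _ => A * β ^ n, analyticAt_const, mul_ne_zero hA (pow_ne_zero _ hβ),
      Eventually.of_forall fun z => ?_⟩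
    have : α + β * z = (z - z₀) * β := by linear_combination h0
    rw [hf, this, zpow_natCast, smul_eq_mul, mul_pow]
    ring
  · exact ⟨f, han, by rw [hf]; exact mul_ne_zero hA (pow_ne_zero _ h0),
      Eventually.of_forall fun z => by simp⟩

/-- In the coordinate `w` the coefficient is `-A (β + α w) ^ n`, so the `n`-fold zero is the root of
the linear form, and it sits at the north pole exactly when `β = 0`. -/
lemma exists_hasDivisor (hd : d = n + 2) (φ : H10 d) {A α β : ℂ} (hA : A ≠ 0)
    (h : α ≠ 0 ∨ β ≠ 0) (hφ : ∀ z, φ.1.1.1 z = A * (α + β * z) ^ n) :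
    ∃ x : OnePoint ℂ, HasDivisor φ (Finsupp.single x (d - 2)) := by
  have hφS : φ.1.1.2 = fun w => -A * (β + α * w) ^ n := by
    refine Continuous.ext_on (dense_compl_singleton (0 : ℂ)) φ.1.2.2.1.continuous
      (by fun_prop) fun w hw => ?_
    have hw : w ≠ 0 := hw
    have e : α + β * w⁻¹ = (β + α * w) * w⁻¹ := by
      field_simp
      ring
    have e2 : w ^ d = w ^ n * w ^ 2 := by
      rw [hd, zpow_add₀ hw]
      norm_cast
    rw [φ.1.2.2.2 w hw, hφ, e, mul_pow, inv_pow]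
    simp only [e2]
    field_simp
  have hdn : d - 2 = n := by omega
  have hN (z : ℂ) : ordAt φ z = _ := meromorphicOrderAt_linear_pow hA n z hφ h
  have hS : ordAt φ OnePoint.infty = _ :=
    meromorphicOrderAt_linear_pow (neg_ne_zero.2 hA) n 0 (congrFun hφS) h.symm
  rw [mul_zero, add_zero] at hS
  rcases eq_or_ne β 0 with rfl | hβ
  · refine ⟨OnePoint.infty, fun x => ?_⟩
    induction x using OnePoint.rec with
    | infty => simp [hS, hdn]
    | coe z =>
      have hα : α ≠ 0 := by simpa using h
      rw [hN]
      simp [hα]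
  · refine ⟨((-α / β : ℂ) : OnePoint ℂ), fun x => ?_⟩
    induction x using OnePoint.rec with
    | infty => simp [hS, hβ]
    | coe z =>
      have : α + β * z = 0 ↔ -α / β = z := by
        rw [div_eq_iff hβ]
        constructor <;> intro h
        · linear_combination (-1) * h
        · linear_combination (-1) * h
      classical
      rw [hN, Finsupp.single_apply, hdn]
      simp only [this, OnePoint.coe_eq_coe]

end Coordinates

/-! ### Line subbundles and pairs of sections -/

/-- Near `z₀`, `k` is a nowhere vanishing holomorphic section of the extension given by `a`. -/
def IsLocalSection (a : ℂ → ℂ) (k : ℂ → ℂ × ℂ) (z₀ : ℂ) : Prop :=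
  ∀ᶠ z in 𝓝 z₀, ContDiffAt ℝ ∞ k z ∧ dbar (fun x => (k x).1) z + a z * (k z).2 = 0 ∧
    dbar (fun x => (k x).2) z = 0 ∧ k z ≠ 0

lemma IsLocalSection.congr {a : ℂ → ℂ} {k l : ℂ → ℂ × ℂ} {z₀ : ℂ} (h : IsLocalSection a k z₀)
    (hkl : l =ᶠ[𝓝 z₀] k) : IsLocalSection a l z₀ := by
  filter_upwards [h, hkl.eventually_nhds] with z ⟨h1, h2, h3, h4⟩ (h5 : l =ᶠ[𝓝 z] k)
  have e1 : (fun x => (l x).1) =ᶠ[𝓝 z] fun x => (k x).1 := h5.fun_comp Prod.fst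
  have e2 : (fun x => (l x).2) =ᶠ[𝓝 z] fun x => (k x).2 := h5.fun_comp Prod.snd
  exact ⟨h1.congr_of_eventuallyEq h5, by rw [dbar_congr e1, h5.eq_of_nhds, h2],
    by rw [dbar_congr e2, h3], by rwa [h5.eq_of_nhds]⟩

lemma IsLocalSection.smul {a : ℂ → ℂ} {k : ℂ → ℂ × ℂ} {z₀ : ℂ} (h : IsLocalSection a k z₀)
    {Q : ℂ → ℂ} (hQ : AnalyticAt ℂ Q z₀) (hQ0 : Q z₀ ≠ 0) :
    IsLocalSection a (fun z => Q z • k z) z₀ := by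
  filter_upwards [h, hQ.eventually_analyticAt, hQ.continuousAt.eventually_ne hQ0]
    with z ⟨h1, h2, h3, h4⟩ h5 h6
  have d1 : DifferentiableAt ℝ (fun x => (k x).1) z := (h1.fst.differentiableAt (by simp))
  have d2 : DifferentiableAt ℝ (fun x => (k x).2) z := (h1.snd.differentiableAt (by simp))
  refine ⟨(h5.contDiffAt.restrict_scalars ℝ).smul h1, ?_, ?_, smul_ne_zero h6 h4⟩
  · simp only [Prod.smul_fst, Prod.smul_snd, smul_eq_mul]
    rw [dbar_holo_mul h5.differentiableAt d1]
    linear_combination Q z * h2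
  · simp only [Prod.smul_snd, smul_eq_mul]
    rw [dbar_holo_mul h5.differentiableAt d2, h3, mul_zero]

lemma IsLocalFrame.isLocalSection {a : ℂ → ℂ} {J : ℂ → Submodule ℂ (ℂ × ℂ)} {ζ : ℂ → ℂ × ℂ} {z₀ : ℂ}
    (h : IsLocalFrame a J ζ z₀) : IsLocalSection a ζ z₀ :=
  h.mono fun _ h => ⟨h.1, h.2.1, h.2.2.1, h.2.2.2.1⟩

/-- The values of a meromorphic section at the points of its divisor are arbitrary. Replacing every
value by the punctured limit fills the removable singularities left after dividing out the divisor.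
-/
lemma limUnder_eventuallyEq {h k : ℂ → ℂ × ℂ} {z₀ : ℂ} (hk : ∀ᶠ z in 𝓝 z₀, ContinuousAt k z)
    (hhk : h =ᶠ[𝓝[≠] z₀] k) : (fun z => limUnder (𝓝[≠] z) h) =ᶠ[𝓝 z₀] k := by
  have h1 : ∀ᶠ y in 𝓝 z₀, y ≠ z₀ → h y = k y := eventually_nhdsWithin_iff.1 hhk
  filter_upwards [hk, h1.eventually_nhds] with z hz hz1
  refine Tendsto.limUnder_eq (((hz.tendsto).mono_left nhdsWithin_le_nhds).congr' ?_)
  rcases eq_or_ne z z₀ with rfl | hne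
  · exact hhk.symm
  · refine Filter.EventuallyEq.filter_mono ?_ nhdsWithin_le_nhds
    filter_upwards [hz1, eventually_ne_nhds hne] with y hy hy' using (hy hy').symm

lemma tendsto_limUnder_of_eventuallyEq {h k : ℂ → ℂ × ℂ} {z₀ : ℂ} (hk : ContinuousAt k z₀)
    (hhk : h =ᶠ[𝓝[≠] z₀] k) : Tendsto h (𝓝[≠] z₀) (𝓝 (limUnder (𝓝[≠] z₀) h)) :=
  tendsto_nhds_limUnder ⟨k z₀, ((hk.tendsto).mono_left nhdsWithin_le_nhds).congr' hhk.symm⟩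

lemma zpow_sum {ι : Type*} {w : ℂ} (hw : w ≠ 0) (S : Finset ι) (e : ι → ℤ) :
    w ^ (∑ c ∈ S, e c) = ∏ c ∈ S, w ^ e c := by
  classical
  induction S using Finset.induction_on with
  | empty => simp
  | insert c S hc ih => rw [Finset.sum_insert hc, Finset.prod_insert hc, zpow_add₀ hw, ih]

lemma analyticAt_prod_zpow (S : Finset ℂ) (e : ℂ → ℤ) (ℓ : ℂ → ℂ → ℂ) {z₀ : ℂ}
    (hℓ : ∀ c ∈ S, AnalyticAt ℂ (ℓ c) z₀ ∧ ℓ c z₀ ≠ 0) :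
    AnalyticAt ℂ (fun z => ∏ c ∈ S, ℓ c z ^ e c) z₀ ∧ ∏ c ∈ S, ℓ c z₀ ^ e c ≠ 0 :=
  ⟨Finset.analyticAt_fun_prod _ fun c hc => (hℓ c hc).1.zpow (hℓ c hc).2,
    Finset.prod_ne_zero_iff.2 fun c hc => zpow_ne_zero _ (hℓ c hc).2⟩

section Subbundles

variable {d₁ d₂ : ℤ} {η : Omega01 (-(d₂ - d₁))}

/-- A holomorphic line subbundle of degree `m` gives holomorphic sections of `L₁ ⊗ O(-m)` and
`L₂ ⊗ O(-m)`, coupled by `η`, without common zeros on `S² ∖ N`. -/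
lemma exists_sections_of_hasDegree {J : HolLineSubbundle d₁ d₂ η} {m : ℤ} (hJ : J.HasDegree m) :
    ∃ (F₁ : Omega00 (d₁ - m)) (F₂ : Omega00 (d₂ - m)), ∀ z,
      dbar F₁.1.1 z + η.1.1 z * F₂.1.1 z = 0 ∧ dbar F₂.1.1 z = 0 ∧
      (F₁.1.1 z, F₂.1.1 z) ≠ 0 := by
  classical
  obtain ⟨ψ, hψ⟩ := hJ
  set D := ψ.divisor
  let S : Finset ℂ := D.support.preimage (fun z : ℂ => (z : OnePoint ℂ))
    (OnePoint.coe_injective.injOn)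
  have hS (z : ℂ) : z ∉ S → D (z : OnePoint ℂ) = 0 := by
    simp [S]
  have hm : m = D OnePoint.infty + ∑ z ∈ S, D (z : OnePoint ℂ) := by
    rw [← hψ, Finsupp.sum_of_support_subset D
      (s := insert OnePoint.infty (S.map ⟨_, OnePoint.coe_injective⟩)) ?_ _ (fun _ _ => rfl)]
    · rw [Finset.sum_insert (by simp), Finset.sum_map]
      rfl
    · intro x hx
      induction x using OnePoint.rec with
      | infty => simp
      | coe z =>
        refine Finset.mem_insert_of_mem (Finset.mem_map.2 ⟨z, ?_, rfl⟩)
        simpa [S] using hx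
  -- Multiplication by this rational function cancels the divisor of `ψ` on `S² ∖ N`, which moves
  -- the whole degree `m` to the north pole.
  let P : ℂ → ℂ := fun z => ∏ c ∈ S, (z - c) ^ (-D (c : OnePoint ℂ))
  let h : ℂ → ℂ × ℂ := fun z => P z • ψ.secN z
  let F : ℂ → ℂ × ℂ := fun z => limUnder (𝓝[≠] z) h
  have hloc (z₀ : ℂ) : ∃ k, IsLocalSection η.1.1 k z₀ ∧ h =ᶠ[𝓝[≠] z₀] k := by
    obtain ⟨ζ, hζ, hsec⟩ := ψ.order_coe z₀
    obtain ⟨hQ, hQ0⟩ := analyticAt_prod_zpow (S.erase z₀) (fun c => -D (c : OnePoint ℂ))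
      (fun c z => z - c) (z₀ := z₀) (fun c hc =>
        ⟨by fun_prop, sub_ne_zero.2 (Finset.ne_of_mem_erase hc).symm⟩)
    refine ⟨_, hζ.isLocalSection.smul hQ hQ0, ?_⟩
    filter_upwards [hsec, self_mem_nhdsWithin] with z hz hne
    have hne : z - z₀ ≠ 0 := sub_ne_zero.2 hne
    have hP : P z * (z - z₀) ^ D (z₀ : OnePoint ℂ) =
        ∏ c ∈ S.erase z₀, (z - c) ^ (-D (c : OnePoint ℂ)) := by
      by_cases hzS : z₀ ∈ S
      · simp only [P]
        rw [← Finset.mul_prod_erase S _ hzS, mul_right_comm, ← zpow_add₀ hne, neg_add_cancel,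
          zpow_zero, one_mul]
      · rw [hS z₀ hzS, zpow_zero, mul_one, Finset.erase_eq_of_notMem hzS]
    simp only [h]
    rw [hz, smul_smul, hP]
  have hcont {a : ℂ → ℂ} {k : ℂ → ℂ × ℂ} {z₀ : ℂ} (hk : IsLocalSection a k z₀) :
      ∀ᶠ z in 𝓝 z₀, ContinuousAt k z := hk.mono fun z hz => hz.1.continuousAt
  have hF (z₀ : ℂ) : IsLocalSection η.1.1 F z₀ := by
    obtain ⟨k, hk, hkh⟩ := hloc z₀
    exact hk.congr (limUnder_eventuallyEq (hcont hk) hkh)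
  have hFt (z₀ : ℂ) : Tendsto h (𝓝[≠] z₀) (𝓝 (F z₀)) := by
    obtain ⟨k, hk, hkh⟩ := hloc z₀
    exact tendsto_limUnder_of_eventuallyEq (hcont hk).self_of_nhds hkh
  -- The factor `w ^ (-m)` removes the order `m` now concentrated at the north pole. It is also what
  -- twists the transition functions to the degrees `d₁ - m` and `d₂ - m`.
  let hh : ℂ → ℂ × ℂ := fun w => (w ^ (-m) * P w⁻¹) • ψ.secS w
  let G : ℂ → ℂ × ℂ := fun w => limUnder (𝓝[≠] w) hh
  have hG0 : IsLocalSection η.1.2 G 0 := by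
    obtain ⟨ζ, hζ, hsec⟩ := ψ.order_infty
    obtain ⟨hU, hU0⟩ := analyticAt_prod_zpow S (fun c => -D (c : OnePoint ℂ))
      (fun c w => 1 - c * w) (z₀ := 0) (fun c _ => ⟨by fun_prop, by simp⟩)
    have hk := hζ.isLocalSection.smul hU hU0
    refine hk.congr (limUnder_eventuallyEq (hcont hk) ?_)
    filter_upwards [hsec, self_mem_nhdsWithin] with w hw hne
    have hne : w ≠ 0 := hne
    have hP : P w⁻¹ = w ^ (∑ c ∈ S, D (c : OnePoint ℂ)) *
        ∏ c ∈ S, (1 - c * w) ^ (-D (c : OnePoint ℂ)) := by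
      simp only [P]
      rw [zpow_sum hne, ← Finset.prod_mul_distrib]
      refine Finset.prod_congr rfl fun c _ => ?_
      have : w⁻¹ - c = w⁻¹ * (1 - c * w) := by field_simp
      rw [this, mul_zpow, inv_zpow, zpow_neg w, inv_inv]
    simp only [hh]
    rw [hw, smul_smul, hP]
    congr 1
    have : w ^ (-m) * w ^ (∑ c ∈ S, D (c : OnePoint ℂ)) * w ^ D OnePoint.infty = 1 := by
      rw [← zpow_add₀ hne, ← zpow_add₀ hne, hm]
      simp
    linear_combination (∏ c ∈ S, (1 - c * w) ^ (-D (c : OnePoint ℂ))) * this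
  have hglue (w : ℂ) (hw : w ≠ 0) :
      G w = (w ^ (d₁ - m) * (F w⁻¹).1, w ^ (d₂ - m) * (F w⁻¹).2) := by
    refine Tendsto.limUnder_eq ?_
    have hinv : Tendsto (fun w : ℂ => w⁻¹) (𝓝[≠] w) (𝓝[≠] w⁻¹) :=
      (tendsto_inv₀ hw).inf (tendsto_principal_principal.2 fun x hx => inv_injective.ne hx)
    have hc (e : ℤ) : Tendsto (fun w : ℂ => w ^ e) (𝓝[≠] w) (𝓝 (w ^ e)) :=
      (continuousAt_zpow₀ w e (Or.inl hw)).tendsto.mono_left nhdsWithin_le_nhds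
    have ht := (hFt w⁻¹).comp hinv
    have h1 := (hc (d₁ - m)).mul ((continuous_fst.tendsto _).comp ht)
    have h2 := (hc (d₂ - m)).mul ((continuous_snd.tendsto _).comp ht)
    refine (h1.prodMk_nhds h2).congr' ?_
    filter_upwards [nhdsWithin_le_nhds (isOpen_ne.mem_nhds hw)] with x hx
    have hx : x ≠ 0 := hx
    simp only [Function.comp_apply, h, hh, ψ.glue x hx, Prod.smul_mk, Prod.smul_fst, Prod.smul_snd,
      smul_eq_mul, sub_eq_add_neg, zpow_add₀ hx]
    congr 1 <;> ring
  have hFs : ContDiff ℝ ∞ F := contDiff_iff_contDiffAt.2 fun z => (hF z).self_of_nhds.1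
  have hGs : ContDiff ℝ ∞ G := by
    refine contDiff_iff_contDiffAt.2 fun w => ?_
    rcases eq_or_ne w 0 with rfl | hw
    · exact hG0.self_of_nhds.1
    · have hev : G =ᶠ[𝓝 w] fun w => (w ^ (d₁ - m) * (F w⁻¹).1, w ^ (d₂ - m) * (F w⁻¹).2) := by
        filter_upwards [isOpen_ne.mem_nhds hw] with x hx using hglue x hx
      refine ContDiffAt.congr_of_eventuallyEq ?_ hev
      have hz (e : ℤ) : ContDiffAt ℝ ∞ (fun w : ℂ => w ^ e) w := by
        have h : AnalyticAt ℂ (fun w : ℂ => w ^ e) w := analyticAt_id.zpow hw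
        exact h.contDiffAt.restrict_scalars ℝ
      have hi : ContDiffAt ℝ ∞ (fun w : ℂ => F w⁻¹) w :=
        hFs.contDiffAt.comp w (contDiffAt_inv ℝ hw)
      exact ((hz _).mul hi.fst).prodMk ((hz _).mul hi.snd)
  refine ⟨⟨(fun z => (F z).1, fun w => (G w).1), hFs.fst, hGs.fst, fun w hw => ?_⟩,
    ⟨(fun z => (F z).2, fun w => (G w).2), hFs.snd, hGs.snd, fun w hw => ?_⟩, fun z => ?_⟩
  · simp only [hglue w hw]
  · simp only [hglue w hw]
  · exact (hF z).self_of_nhds.2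

/-- The equation is an identity between forms with values in one line bundle, of degree `d₁ - m`, so
it passes from `z` to `w` by `gluedSections_ext`. -/
lemma dbar_snd_of_dbar_fst {m : ℤ} (F₁ : Omega00 (d₁ - m)) (F₂ : Omega00 (d₂ - m))
    (h₁ : ∀ z, dbar F₁.1.1 z + η.1.1 z * F₂.1.1 z = 0) (w : ℂ) :
    dbar F₁.1.2 w + η.1.2 w * F₂.1.2 w = 0 := by
  have hmem : (fun z => η.1.1 z * F₂.1.1 z, fun w => η.1.2 w * F₂.1.2 w) ∈ Omega01 (d₁ - m) := by
    refine ⟨η.2.1.mul F₂.2.1, η.2.2.1.mul F₂.2.2.1, fun w hw => ?_⟩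
    have e : w ^ (d₁ - m) = w ^ (-(d₂ - d₁)) * w ^ (d₂ - m) := by
      rw [← zpow_add₀ hw]
      congr 1
      ring
    simp only [e]
    rw [η.2.2.2 w hw, F₂.2.2.2 w hw]
    ring
  have h : delbar (d₁ - m) F₁ + ⟨_, hmem⟩ = 0 := gluedSections_ext (funext h₁)
  exact congrFun (congrArg (fun s => s.1.2) h) w

lemma dbar_snd_eq_zero {d : ℤ} (F : Omega00 d) (h : ∀ z, dbar F.1.1 z = 0) (w : ℂ) :
    dbar F.1.2 w = 0 := by
  have h : delbar d F = 0 := gluedSections_ext (funext h)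
  exact congrFun (congrArg (fun s => s.1.2) h) w

/-- Coupled holomorphic sections of `L₁ ⊗ O(-m)` and `L₂ ⊗ O(-m)` without common zeros give a
holomorphic line subbundle of degree `m`. -/
lemma exists_hasDegree_of_sections {m : ℤ} (F₁ : Omega00 (d₁ - m)) (F₂ : Omega00 (d₂ - m))
    (h₁ : ∀ z, dbar F₁.1.1 z + η.1.1 z * F₂.1.1 z = 0) (h₂ : ∀ z, dbar F₂.1.1 z = 0)
    (h0 : ∀ z, (F₁.1.1 z, F₂.1.1 z) ≠ 0) (hinf : (F₁.1.2 0, F₂.1.2 0) ≠ 0) :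
    ∃ J : HolLineSubbundle d₁ d₂ η, J.HasDegree m := by
  have hS0 (w : ℂ) : (F₁.1.2 w, F₂.1.2 w) ≠ 0 := by
    rcases eq_or_ne w 0 with rfl | hw
    · exact hinf
    · intro h
      refine h0 w⁻¹ ?_
      simp only [Prod.mk_eq_zero, F₁.2.2.2 w hw, F₂.2.2.2 w hw, mul_eq_zero, zpow_ne_zero _ hw,
        false_or] at h
      simp [h.1, h.2]
  have fN (z₀ : ℂ) : IsLocalFrame η.1.1 (fun z => Submodule.span ℂ {(F₁.1.1 z, F₂.1.1 z)})
      (fun z => (F₁.1.1 z, F₂.1.1 z)) z₀ :=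
    Eventually.of_forall fun z => ⟨(F₁.2.1.prodMk F₂.2.1).contDiffAt, h₁ z, h₂ z, h0 z, rfl⟩
  have fS (w₀ : ℂ) : IsLocalFrame η.1.2 (fun w => Submodule.span ℂ {(F₁.1.2 w, F₂.1.2 w)})
      (fun w => (F₁.1.2 w, F₂.1.2 w)) w₀ :=
    Eventually.of_forall fun w => ⟨(F₁.2.2.1.prodMk F₂.2.2.1).contDiffAt,
      dbar_snd_of_dbar_fst F₁ F₂ h₁ w, dbar_snd_eq_zero F₂ h₂ w, hS0 w, rfl⟩
  -- The meromorphic section is the pair itself. It is a frame on `S² ∖ N`, and undoing the twist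
  -- makes it `w ^ m` times the frame at the north pole, whence the divisor `m` at that point.
  refine ⟨⟨_, _, fun w hw u v => ?_, fun z₀ => ⟨_, fN z₀⟩, fun w₀ => ⟨_, fS w₀⟩⟩,
    ⟨fun z => (F₁.1.1 z, F₂.1.1 z), fun w => (w ^ d₁ * F₁.1.1 w⁻¹, w ^ d₂ * F₂.1.1 w⁻¹),
      fun w _ => rfl, Finsupp.single OnePoint.infty m, fun z₀ => ⟨_, fN z₀, ?_⟩, ⟨_, fS 0, ?_⟩⟩, ?_⟩
  · have h1 := zpow_ne_zero d₁ hw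
    have h2 := zpow_ne_zero d₂ hw
    have h3 := zpow_ne_zero m hw
    simp only [Submodule.mem_span_singleton, Prod.smul_mk, Prod.mk.injEq, smul_eq_mul,
      F₁.2.2.2 w hw, F₂.2.2.2 w hw, zpow_sub₀ hw]
    constructor
    · rintro ⟨c, hc1, hc2⟩
      refine ⟨c / w ^ m, mul_left_cancel₀ h1 ?_, mul_left_cancel₀ h2 ?_⟩
      · rw [← hc1]
        ring
      · rw [← hc2]
        ring
    · rintro ⟨c, rfl, rfl⟩
      refine ⟨c * w ^ m, ?_, ?_⟩ <;> field_simp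
  · exact Eventually.of_forall fun z => by simp
  · filter_upwards [self_mem_nhdsWithin] with w hw
    have hw : w ≠ 0 := hw
    have h3 := zpow_ne_zero m hw
    simp only [F₁.2.2.2 w hw, F₂.2.2.2 w hw, zpow_sub₀ hw, Finsupp.single_eq_same, Prod.smul_mk,
      smul_eq_mul, Prod.mk.injEq]
    constructor <;> field_simp
  · simp

end Subbundles

/-! ### The extensions with a line subbundle of degree `deg L₂ - 1` -/

/-- If `s ≠ 0`, everything is determined by `x 0`. If `s = 0`, all terms before the last one vanish.
-/
lemma exists_eq_mul_pow_of_recursion {n : ℕ} {s t : ℂ} (hst : s ≠ 0 ∨ t ≠ 0) {x : ℕ → ℂ}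
    (hx : ∀ j < n, s * x (j + 1) = t * x j) : ∃ A, ∀ j ≤ n, x j = A * (s ^ (n - j) * t ^ j) := by
  rcases eq_or_ne s 0 with rfl | hs
  · have ht : t ≠ 0 := by simpa using hst
    -- Here `0 ^ (n - j)` is `1` for `j = n` and `0` otherwise, so the constant is read off from the
    -- last term.
    refine ⟨x n / t ^ n, fun j hj => ?_⟩
    rcases hj.eq_or_lt with rfl | hj
    · simp
      field_simp
    · have := hx j hj
      rw [zero_mul, eq_comm, mul_eq_zero] at this
      rw [this.resolve_left ht, zero_pow (by omega)]
      simp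
  · refine ⟨x 0 / s ^ n, fun j => ?_⟩
    induction j with
    | zero => intro _; simp; field_simp
    | succ j ih =>
      intro hj
      refine mul_left_cancel₀ hs ?_
      rw [hx j (by omega), ih (by omega)]
      have : n - j = n - (j + 1) + 1 := by omega
      rw [this]
      ring

variable {d₁ d₂ : ℤ} {n : ℕ}

lemma eq_zero_of_omega00_neg {d : ℤ} (F : Omega00 d) (hd : d < 0) (h : ∀ z, dbar F.1.1 z = 0)
    (z : ℂ) : F.1.1 z = 0 :=
  eq_zero_of_holomorphic_of_neg (differentiable_of_dbar_eq_zero F.2.1 h) F.2.2.1.continuous hd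
    F.2.2.2 z

lemma cls_eq_zero_iff {d : ℤ} (η : Omega01 d) : cls η = 0 ↔ η ∈ LinearMap.range (delbar d) :=
  Submodule.Quotient.mk_eq_zero _

lemma coe_dbar_mul_const {d : ℤ} (c : ℂ) (F : Omega00 d) (z : ℂ) :
    dbar (c • F.1.1) z = c * dbar F.1.1 z := dbar_smul c (F.2.1.differentiable (by simp) z)

/-- A nontrivial extension has no line subbundle of degree at least `deg L₂`. -/
lemma degree_le (hk : d₂ - d₁ = n + 2) {η : Omega01 (-(d₂ - d₁))} (hη : cls η ≠ 0)
    {J : HolLineSubbundle d₁ d₂ η} {m : ℤ} (hJ : J.HasDegree m) : m ≤ d₂ - 1 := by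
  by_contra! hm
  obtain ⟨F₁, F₂, hF⟩ := exists_sections_of_hasDegree hJ
  -- If `F₂ = 0`, then `F₁` is a holomorphic section for the negative degree `d₁ - m`, so the pair
  -- would vanish.
  have hne : ∃ z, F₂.1.1 z ≠ 0 := by
    by_contra! h0
    have h1 (z : ℂ) : F₁.1.1 z = 0 :=
      eq_zero_of_omega00_neg F₁ (by omega) (fun z => by simpa [h0 z] using (hF z).1) z
    exact (hF 0).2.2 (by simp [h0, h1])
  obtain ⟨z₁, hz₁⟩ := hne
  rcases lt_or_ge (d₂ - m) 0 with h | h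
  · exact hz₁ (eq_zero_of_omega00_neg F₂ h (fun z => (hF z).2.1) z₁)
  -- Now `F₂` is a nonzero constant `c 0`, and `-F₁ / c 0` is a primitive of `η`: the extension
  -- would split.
  · obtain rfl : m = d₂ := by omega
    obtain ⟨c, hc⟩ := exists_eq_sum_of_holomorphic 0
      (differentiable_of_dbar_eq_zero F₂.2.1 fun z => (hF z).2.1) F₂.2.2.1.continuous
      (fun w hw => by simpa using F₂.2.2.2 w hw)
    simp only [zero_add, Finset.range_one, Finset.sum_singleton, pow_zero, mul_one] at hc
    have hc0 : c 0 ≠ 0 := by rwa [hc] at hz₁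
    have hs : (F₁.1.1, F₁.1.2) ∈ Omega00 (-(m - d₁)) := by
      rw [neg_sub]
      exact F₁.2
    refine hη ((cls_eq_zero_iff η).2 ⟨-(c 0)⁻¹ • ⟨_, hs⟩, gluedSections_ext (funext fun z => ?_)⟩)
    change dbar ((-(c 0)⁻¹) • F₁.1.1) z = η.1.1 z
    have h1 := (hF z).1
    rw [hc] at h1
    rw [coe_dbar_mul_const]
    field_simp
    linear_combination (-1) * h1

/-- If a nontrivial extension has a line subbundle of degree `deg L₂ - 1`, its coordinates are in
geometric progression. -/
lemma exists_eq_mul_pow_of_hasDegree (hk : d₂ - d₁ = n + 2) {η : Omega01 (-(d₂ - d₁))}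
    {J : HolLineSubbundle d₁ d₂ η} (hJ : J.HasDegree (d₂ - 1)) :
    ∃ s t A : ℂ, (s ≠ 0 ∨ t ≠ 0) ∧
      ∀ j : Fin (n + 1), momentMap hk η j = A * (s ^ (n - (j : ℕ)) * t ^ (j : ℕ)) := by
  obtain ⟨F₁, F₂, hF⟩ := exists_sections_of_hasDegree hJ
  obtain ⟨c, hc⟩ := exists_eq_sum_of_holomorphic 1
    (differentiable_of_dbar_eq_zero F₂.2.1 fun z => (hF z).2.1) F₂.2.2.1.continuous
    (fun w hw => by simpa using F₂.2.2.2 w hw)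
  simp only [Finset.sum_range_succ, Finset.range_zero, Finset.sum_empty, pow_zero, mul_one,
    zero_add, pow_one] at hc
  -- The parameters will be `s = c 1`, `t = -c 0`, so that `t / s` is the zero of `F₂ = c 0 + c 1
  -- z`.
  have hne : c 1 ≠ 0 ∨ -c 0 ≠ 0 := by
    by_contra! h0
    rw [neg_eq_zero] at h0
    have h2 (z : ℂ) : F₂.1.1 z = 0 := by simp [hc, h0.1, h0.2]
    have h1 (z : ℂ) : F₁.1.1 z = 0 :=
      eq_zero_of_omega00_neg F₁ (by omega) (fun z => by simpa [h2 z] using (hF z).1) z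
    exact (hF 0).2.2 (by simp [h1, h2])
  -- The form `η F₂` is exact for the degree `d₁ - d₂ + 1 = -(n + 1)`, so its moments vanish for `j
  -- < n`. Each of them is a combination of two consecutive moments of `η`.
  have hrec : ∀ j < n, c 1 * (2 * ∫ z, z ^ (j + 1) * η.1.1 z) =
      -c 0 * (2 * ∫ z, z ^ j * η.1.1 z) := by
    intro j hj
    have h0 := integral_pow_mul_dbar_eq_zero F₁ (j := j) (by omega)
    have e (z : ℂ) : z ^ j * dbar F₁.1.1 z =
        (-c 0) * (z ^ j * η.1.1 z) - c 1 * (z ^ (j + 1) * η.1.1 z) := by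
      have := (hF z).1
      rw [hc] at this
      linear_combination z ^ j * this
    simp only [e] at h0
    rw [integral_sub ((integrable_pow_mul_Omega01 η (by omega)).const_mul _)
      ((integrable_pow_mul_Omega01 η (by omega)).const_mul _), integral_const_mul,
      integral_const_mul] at h0
    linear_combination (-2) * h0
  obtain ⟨A, hA⟩ := exists_eq_mul_pow_of_recursion hne
    (x := fun j => 2 * ∫ z, z ^ j * η.1.1 z) hrec
  exact ⟨_, _, A, hne, fun j => hA j (by omega)⟩

/-- Seen from the north pole, the last moment is the moment of order zero. It decides whether the
section built below vanishes there. -/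
lemma integral_snd_eq (hk : d₂ - d₁ = n + 2) (η : Omega01 (-(d₂ - d₁))) :
    ∫ w, η.1.2 w = -∫ z, z ^ n * η.1.1 z := by
  rw [integral_comp_inv, ← integral_neg]
  refine integral_congr_ae ?_
  filter_upwards [compl_mem_ae_iff.2 (measure_singleton (0 : ℂ))] with z hz
  have hz : z ≠ 0 := hz
  have hz' : conj z ≠ 0 := by simpa using hz
  have hn : ((‖z‖ ^ 4 : ℝ) : ℂ) = z ^ 2 * conj z ^ 2 := by
    rw [← mul_pow, Complex.mul_conj, Complex.normSq_eq_norm_sq]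
    push_cast
    ring
  have hd : z⁻¹ ^ (-(d₂ - d₁)) = z ^ (n + 2) := by
    rw [hk, inv_zpow, zpow_neg, inv_inv]
    norm_cast
  rw [η.2.2.2 _ (inv_ne_zero hz), inv_inv, Complex.real_smul, Complex.ofReal_inv, hn]
  simp only [hd, map_inv₀, pow_add]
  field_simp

/-- Take `F₂ = s z - t`. The progression says that the moments of `F₂ η` vanish, so minus its Cauchy
transform is an admissible `F₁`. At the zero of `F₂` the kernel cancels against `F₂`, leaving a
nonzero multiple of an extreme moment of `η`, `A s ^ n` or `A t ^ n`. -/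
lemma exists_hasDegree (hk : d₂ - d₁ = n + 2) {η : Omega01 (-(d₂ - d₁))} {s t A : ℂ}
    (hst : s ≠ 0 ∨ t ≠ 0) (hA : A ≠ 0)
    (h : ∀ j : Fin (n + 1), momentMap hk η j = A * (s ^ (n - (j : ℕ)) * t ^ (j : ℕ))) :
    ∃ J : HolLineSubbundle d₁ d₂ η, J.HasDegree (d₂ - 1) := by
  have hmom (j : ℕ) (hj : j ≤ n) : 2 * ∫ z, z ^ j * η.1.1 z = A * (s ^ (n - j) * t ^ j) :=
    h ⟨j, by omega⟩
  have hθ : (fun z => (s * z - t) * η.1.1 z, fun w => (s - t * w) * η.1.2 w) ∈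
      Omega01 (d₁ - (d₂ - 1)) := by
    refine ⟨((contDiff_const.mul contDiff_id).sub contDiff_const).mul η.2.1,
      (contDiff_const.sub (contDiff_const.mul contDiff_id)).mul η.2.2.1, fun w hw => ?_⟩
    have e : w ^ (d₁ - (d₂ - 1)) = w ^ (-(d₂ - d₁)) * w := by
      rw [← zpow_add_one₀ hw]
      congr 1
      ring
    simp only [e]
    rw [η.2.2.2 w hw]
    field_simp
  obtain ⟨hT, hTd⟩ := cauchyTransform_mem ⟨_, hθ⟩ (by omega) (fun j hj => by
    have e (z : ℂ) : z ^ j * ((s * z - t) * η.1.1 z) =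
        s * (z ^ (j + 1) * η.1.1 z) - t * (z ^ j * η.1.1 z) := by ring
    simp only [e]
    rw [integral_sub ((integrable_pow_mul_Omega01 η (by omega)).const_mul _)
      ((integrable_pow_mul_Omega01 η (by omega)).const_mul _), integral_const_mul,
      integral_const_mul]
    have h1 := hmom j (by omega)
    have h2 := hmom (j + 1) (by omega)
    have h3 : n - j = n - (j + 1) + 1 := by omega
    rw [h3] at h1
    linear_combination (s / 2) * h2 - (t / 2) * h1)
  have hF₂ : (fun z => s * z - t, fun w => s - t * w) ∈ Omega00 (d₂ - (d₂ - 1)) := by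
    refine ⟨(contDiff_const.mul contDiff_id).sub contDiff_const,
      contDiff_const.sub (contDiff_const.mul contDiff_id), fun w hw => ?_⟩
    have e : d₂ - (d₂ - 1) = 1 := by ring
    simp only [e, zpow_one]
    field_simp
  have hF₁ := (Omega00 (d₁ - (d₂ - 1))).neg_mem hT
  refine exists_hasDegree_of_sections (m := d₂ - 1) ⟨_, hF₁⟩ ⟨_, hF₂⟩ (fun z => ?_) (fun z => ?_)
    (fun z => ?_) ?_
  · have h1 : dbar ((-1 : ℂ) • cauchyTransform fun z => (s * z - t) * η.1.1 z) z = _ :=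
      dbar_smul _ (hT.1.differentiable (by simp) z)
    have h2 : dbar (cauchyTransform fun z => (s * z - t) * η.1.1 z) z = (s * z - t) * η.1.1 z :=
      hTd z
    rw [neg_one_smul] at h1
    change dbar (-cauchyTransform fun z => (s * z - t) * η.1.1 z) z + η.1.1 z * (s * z - t) = 0
    rw [h1, h2]
    ring
  · exact dbar_eq_zero (f := fun z => s * z - t) (by fun_prop)
  · intro h0
    simp only [Prod.mk_eq_zero] at h0
    obtain ⟨h0, h1⟩ := h0
    have h0 : -cauchyTransform (fun z => (s * z - t) * η.1.1 z) z = 0 := h0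
    have hs : s ≠ 0 := by
      rintro rfl
      simp at h1 hst
      exact hst h1
    -- At the zero `z = t / s` the linear form is `-s (z - x)`, so the Cauchy integral collapses to
    -- the moment of order `0`, which is nonzero as `s ≠ 0`. The equality fails only possibly at `x
    -- = z`, where the inverse takes the value `0`.
    have e : (fun x => (s * x - t) * η.1.1 x * (z - x)⁻¹) =ᵐ[volume] fun x =>
        -s * (x ^ 0 * η.1.1 x) := by
      filter_upwards [compl_mem_ae_iff.2 (measure_singleton z)] with x hx
      have hx : z - x ≠ 0 := sub_ne_zero.2 (Ne.symm hx)
      have : s * x - t = -s * (z - x) := by linear_combination h1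
      rw [this]
      field_simp
    rw [cauchyTransform, integral_congr_ae e, integral_const_mul, neg_eq_zero] at h0
    have hm := hmom 0 (by omega)
    have := fsArea_ne_zero
    have h2 : ∫ x, x ^ 0 * η.1.1 x = 0 := by simpa [this, hs] using h0
    rw [h2] at hm
    simp [hA, hs] at hm
  · intro h0
    simp only [Prod.mk_eq_zero, mul_zero, sub_zero] at h0
    obtain ⟨h0, rfl⟩ := h0
    have h0 : -cauchyTransform (fun w => (0 - t * w) * η.1.2 w) 0 = 0 := h0
    have ht : t ≠ 0 := by simpa using hst
    -- A zero of `F₂` at the north pole means `s = 0`. The kernel again cancels, and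
    -- `integral_snd_eq` identifies what is left with the moment of order `n`.
    have e : (fun x => (0 - t * x) * η.1.2 x * (0 - x)⁻¹) =ᵐ[volume] fun x => t * η.1.2 x := by
      filter_upwards [compl_mem_ae_iff.2 (measure_singleton (0 : ℂ))] with x hx
      have hx : x ≠ 0 := hx
      rw [zero_sub, zero_sub]
      field_simp
    rw [cauchyTransform, integral_congr_ae e, integral_const_mul, integral_snd_eq hk,
      neg_eq_zero] at h0
    have hm := hmom n le_rfl
    have := fsArea_ne_zero
    have h2 : ∫ x, x ^ n * η.1.1 x = 0 := by
      simpa [this, ht] using h0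
    rw [h2] at hm
    simp [hA, ht] at hm

/-! ### The supremum of the degrees and the level set -/

lemma divExt_le (hk : d₂ - d₁ = n + 2) {η : Omega01 (-(d₂ - d₁))} (hη : cls η ≠ 0) :
    divExt d₁ d₂ η ≤ (((d₂ - 1 : ℤ) : ℝ) : EReal) := by
  refine sSup_le ?_
  rintro _ ⟨J, m, hJ, rfl⟩
  exact_mod_cast degree_le hk hη hJ

lemma momentMap_ne_zero (hk : d₂ - d₁ = n + 2) {η : Omega01 (-(d₂ - d₁))} (hη : cls η ≠ 0) :
    momentMap hk η ≠ 0 := by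
  rw [← coordEquiv_cls]
  exact (coordEquiv hk).map_ne_zero_iff.2 hη

/-- A nontrivial extension satisfies `div[η] ≥ deg L₂ - 1` if and only if its coordinates are in
geometric progression. -/
lemma le_divExt_iff (hk : d₂ - d₁ = n + 2) {η : Omega01 (-(d₂ - d₁))} (hη : cls η ≠ 0) :
    (((d₂ - 1 : ℤ) : ℝ) : EReal) ≤ divExt d₁ d₂ η ↔ ∃ s t A : ℂ, (s ≠ 0 ∨ t ≠ 0) ∧ A ≠ 0 ∧
      ∀ j : Fin (n + 1), momentMap hk η j = A * (s ^ (n - (j : ℕ)) * t ^ (j : ℕ)) := by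
  constructor
  · intro h
    -- Degrees are integers, so passing to a strict bound by `d₂ - 2` replaces attainment of the
    -- supremum: some subbundle has degree above `d₂ - 2`, hence equal to `d₂ - 1` by `degree_le`.
    have hlt : (((d₂ - 2 : ℤ) : ℝ) : EReal) < divExt d₁ d₂ η := by
      refine lt_of_lt_of_le ?_ h
      exact_mod_cast (by omega : d₂ - 2 < d₂ - 1)
    obtain ⟨_, ⟨J, m, hJ, rfl⟩, hm⟩ := lt_sSup_iff.1 hlt
    have hm : d₂ - 2 < m := by exact_mod_cast hm
    obtain rfl : m = d₂ - 1 := le_antisymm (degree_le hk hη hJ) (by omega)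
    obtain ⟨s, t, A, hst, hA⟩ := exists_eq_mul_pow_of_hasDegree hk hJ
    refine ⟨s, t, A, hst, ?_, hA⟩
    rintro rfl
    exact momentMap_ne_zero hk hη (funext fun j => by simp [hA])
  · rintro ⟨s, t, A, hst, hA, h⟩
    obtain ⟨J, hJ⟩ := exists_hasDegree hk hst hA h
    exact le_sSup ⟨J, _, hJ, rfl⟩

/-- The level set quantifies over all forms representing a point. A rescaling is absorbed in `A`, so
one class decides for all of them. -/
lemma mem_P01Level_iff (hk : d₂ - d₁ = n + 2) {c : H01 (-(d₂ - d₁))} (hc : c ≠ 0) :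
    Projectivization.mk ℂ c hc ∈ P01Level d₁ d₂ 1 ↔ ∃ s t A : ℂ, (s ≠ 0 ∨ t ≠ 0) ∧ A ≠ 0 ∧
      ∀ j : Fin (n + 1), coordEquiv hk c j = A * (s ^ (n - (j : ℕ)) * t ^ (j : ℕ)) := by
  constructor
  · intro h
    obtain ⟨η, rfl⟩ := Submodule.Quotient.mk_surjective _ c
    exact (le_divExt_iff hk hc).1 (h η hc rfl)
  · rintro ⟨s, t, A, hst, hA, h⟩ η hη hηc
    obtain ⟨u, hu⟩ := (Projectivization.mk_eq_mk_iff ℂ _ _ hη hc).1 hηc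
    refine (le_divExt_iff hk hη).2 ⟨s, t, u * A, hst, mul_ne_zero u.ne_zero hA, fun j => ?_⟩
    rw [← coordEquiv_cls, ← hu, Units.smul_def, map_smul, Pi.smul_apply, h, smul_eq_mul, mul_assoc]

end Sphere

namespace CPn

open MeasureTheory Filter Set

/-! ### The rational normal curve -/

/-- The vector of the monomials of degree `n` in two variables. -/
def veroneseVec (n : ℕ) (v : Fin 2 → ℂ) : Fin (n + 1) → ℂ :=
  fun j => v 0 ^ (n - (j : ℕ)) * v 1 ^ (j : ℕ)

lemma veroneseVec_zero (n : ℕ) (v : Fin 2 → ℂ) : veroneseVec n v 0 = v 0 ^ n := by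
  simp [veroneseVec]

lemma veroneseVec_last (n : ℕ) (v : Fin 2 → ℂ) : veroneseVec n v (Fin.last n) = v 1 ^ n := by
  simp [veroneseVec]

lemma veroneseVec_ne_zero (n : ℕ) {v : Fin 2 → ℂ} (hv : v ≠ 0) : veroneseVec n v ≠ 0 := by
  intro h
  have h0 := congrFun h 0
  have h1 := congrFun h (Fin.last n)
  rw [veroneseVec_zero] at h0
  rw [veroneseVec_last] at h1
  refine hv (funext fun i => ?_)
  fin_cases i
  · exact eq_zero_of_pow_eq_zero h0
  · exact eq_zero_of_pow_eq_zero h1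

lemma veroneseVec_smul (n : ℕ) (c : ℂ) (v : Fin 2 → ℂ) :
    veroneseVec n (c • v) = c ^ n • veroneseVec n v := by
  funext j
  have : c ^ n = c ^ (n - (j : ℕ)) * c ^ (j : ℕ) := by
    rw [← pow_add]
    congr 1
    omega
  simp only [veroneseVec, Pi.smul_apply, smul_eq_mul, this]
  ring

/-- The rational normal curve `[s : t] ↦ [sⁿ : sⁿ⁻¹ t : ⋯ : tⁿ]`. -/
noncomputable def veronese (n : ℕ) :
    Projectivization ℂ (Fin 2 → ℂ) → Projectivization ℂ (Fin (n + 1) → ℂ) :=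
  Projectivization.lift
    (fun v => Projectivization.mk ℂ (veroneseVec n v.1) (veroneseVec_ne_zero n v.2)) (by
      rintro ⟨a, ha⟩ ⟨b, hb⟩ t h
      exact (Projectivization.mk_eq_mk_iff' ℂ _ _ _ _).2
        ⟨t ^ n, by rw [← veroneseVec_smul]; exact congrArg _ h.symm⟩)

lemma veronese_mk (n : ℕ) (v : Fin 2 → ℂ) (hv : v ≠ 0) :
    veronese n (Projectivization.mk ℂ v hv) =
      Projectivization.mk ℂ (veroneseVec n v) (veroneseVec_ne_zero n hv) := rfl

lemma continuous_veronese (n : ℕ) : Continuous (veronese n) := by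
  refine (isQuotientMap_mk 1).continuous_iff.2 ?_
  have h : Continuous fun v : {v : Fin 2 → ℂ // v ≠ 0} =>
      (⟨veroneseVec n v.1, veroneseVec_ne_zero n v.2⟩ : {v : Fin (n + 1) → ℂ // v ≠ 0}) := by
    refine Continuous.subtype_mk (continuous_pi fun j => ?_) _
    have h (i : Fin 2) : Continuous fun v : {v : Fin 2 → ℂ // v ≠ 0} => v.1 i :=
      (continuous_apply i).comp continuous_subtype_val
    exact ((h 0).pow _).mul ((h 1).pow _)
  exact (isQuotientMap_mk n).continuous.comp h

/-- In the affine coordinates number `i` and `k`, the map `V` is given by the monomials `x ^ e l`,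
with the exponent `1` for the coordinate `l₀`. -/
structure IsMonomialInCoord {n : ℕ}
    (V : Projectivization ℂ (Fin 2 → ℂ) → Projectivization ℂ (Fin (n + 1) → ℂ))
    (i : Fin 2) (k : Fin (n + 1)) (l₀ : Fin n) (e : Fin n → ℕ) : Prop where
  mem_iff : ∀ p, V p ∈ affineOpen k ↔ p ∈ affineOpen (n := 1) i
  coord_eq : ∀ p, p ∈ affineOpen (n := 1) i →
    ∀ l, affineCoord k (V p) l = affineCoord (n := 1) i p 0 ^ e l
  exponent_eq : e l₀ = 1

/-- Where `s ≠ 0`, the curve is `(x, x², …, x ^ (m + 1))` in `x = t / s`, with the parameter in the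
first place. -/
lemma isMonomialInCoord_zero (m : ℕ) :
    IsMonomialInCoord (veronese (m + 1)) 0 0 0 fun l => (l : ℕ) + 1 where
  mem_iff p := by
    induction p using Projectivization.ind with
    | h v hv =>
      rw [veronese_mk, mk_mem_affineOpen, mk_mem_affineOpen (n := 1), veroneseVec_zero]
      exact pow_ne_zero_iff m.succ_ne_zero
  coord_eq p := by
    induction p using Projectivization.ind with
    | h v hv =>
      intro hp l
      have h0 : v 0 ≠ 0 := (mk_mem_affineOpen (n := 1) 0 v hv).1 hp
      change veroneseVec (m + 1) v (Fin.succAbove 0 l) / veroneseVec (m + 1) v 0 =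
        (v 1 / v 0) ^ ((l : ℕ) + 1)
      have hl : v 0 ^ (m + 1) = v 0 ^ (m + 1 - ((l : ℕ) + 1)) * v 0 ^ ((l : ℕ) + 1) := by
        rw [← pow_add]
        congr 1
        omega
      rw [veroneseVec_zero, hl, div_pow, Fin.zero_succAbove, veroneseVec, Fin.val_succ,
        mul_div_mul_left _ _ (pow_ne_zero _ h0)]
  exponent_eq := by simp

/-- Where `t ≠ 0`, the curve is `(x ^ (m + 1), …, x², x)` in `x = s / t`, with the parameter in the
last place. -/
lemma isMonomialInCoord_one (m : ℕ) :
    IsMonomialInCoord (veronese (m + 1)) 1 (Fin.last _) (Fin.last m)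
      fun l => m + 1 - (l : ℕ) where
  mem_iff p := by
    induction p using Projectivization.ind with
    | h v hv =>
      rw [veronese_mk, mk_mem_affineOpen, mk_mem_affineOpen (n := 1), veroneseVec_last]
      exact pow_ne_zero_iff m.succ_ne_zero
  coord_eq p := by
    induction p using Projectivization.ind with
    | h v hv =>
      intro hp l
      have h1 : v 1 ≠ 0 := (mk_mem_affineOpen (n := 1) 1 v hv).1 hp
      change veroneseVec (m + 1) v (Fin.succAbove (Fin.last _) l) /
        veroneseVec (m + 1) v (Fin.last _) = (v 0 / v 1) ^ (m + 1 - (l : ℕ))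
      have hl : v 1 ^ (m + 1) = v 1 ^ (m + 1 - (l : ℕ)) * v 1 ^ (l : ℕ) := by
        rw [← pow_add]
        congr 1
        omega
      rw [veroneseVec_last, hl, div_pow, Fin.succAbove_last, veroneseVec, Fin.val_castSucc,
        mul_div_mul_right _ _ (pow_ne_zero _ h1)]
  exponent_eq := by simp

/-- The automorphism of affine space which maps the monomial curve with exponents `e` to a
coordinate axis. -/
def shear {n : ℕ} (l₀ : Fin n) (e : Fin n → ℕ) : (Fin n → ℂ) ≃ₜ (Fin n → ℂ) where
  toFun y l := if l = l₀ then y l else y l - y l₀ ^ e l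
  invFun y l := if l = l₀ then y l else y l + y l₀ ^ e l
  left_inv y := by
    funext l
    by_cases h : l = l₀ <;> simp [h]
  right_inv y := by
    funext l
    by_cases h : l = l₀ <;> simp [h]
  continuous_toFun := by
    refine continuous_pi fun l => ?_
    split_ifs <;> fun_prop
  continuous_invFun := by
    refine continuous_pi fun l => ?_
    split_ifs <;> fun_prop

lemma contDiff_shear {n : ℕ} (l₀ : Fin n) (e : Fin n → ℕ) : ContDiff ℂ ω (shear l₀ e) := by
  refine contDiff_pi.2 fun l => ?_
  change ContDiff ℂ ω fun y : Fin n → ℂ => if l = l₀ then y l else y l - y l₀ ^ e l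
  split_ifs <;> fun_prop

lemma contDiff_shear_symm {n : ℕ} (l₀ : Fin n) (e : Fin n → ℕ) :
    ContDiff ℂ ω (shear l₀ e).symm := by
  refine contDiff_pi.2 fun l => ?_
  change ContDiff ℂ ω fun y : Fin n → ℂ => if l = l₀ then y l else y l + y l₀ ^ e l
  split_ifs <;> fun_prop

/-! ### Charts that straighten the rational normal curve -/

lemma affineChart_mem_maximalAtlas {n : ℕ} (i : Fin (n + 1)) :
    affineChart i ∈ IsManifold.maximalAtlas 𝓘(ℂ, Fin n → ℂ) ω
      (Projectivization ℂ (Fin (n + 1) → ℂ)) :=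
  IsManifold.subset_maximalAtlas ⟨i, rfl⟩

/-- The affine chart followed by a shear. -/
noncomputable def shearChart {n : ℕ} (i : Fin (n + 1)) (l₀ : Fin n) (e : Fin n → ℕ) :
    OpenPartialHomeomorph (Projectivization ℂ (Fin (n + 1) → ℂ)) (Fin n → ℂ) :=
  (affineChart i).transHomeomorph (shear l₀ e)

lemma shearChart_mem_maximalAtlas {n : ℕ} (i : Fin (n + 1)) (l₀ : Fin n) (e : Fin n → ℕ) :
    shearChart i l₀ e ∈ IsManifold.maximalAtlas 𝓘(ℂ, Fin n → ℂ) ω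
      (Projectivization ℂ (Fin (n + 1) → ℂ)) := by
  refine (IsManifold.mem_maximalAtlas_iff_contMDiffOn _).2 ⟨?_, ?_⟩
  · exact (contDiff_shear l₀ e).contMDiff.comp_contMDiffOn
      (contMDiffOn_of_mem_maximalAtlas (affineChart_mem_maximalAtlas i))
  · exact (contMDiffOn_symm_of_mem_maximalAtlas (affineChart_mem_maximalAtlas i)).comp
      (contDiff_shear_symm l₀ e).contMDiff.contMDiffOn fun _ hx => hx

/-- Insertion of a coordinate at place `l₀`. -/
noncomputable def insertEquiv {m : ℕ} (l₀ : Fin (m + 1)) :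
    ((Fin 1 → ℂ) × (Fin m → ℂ)) ≃L[ℂ] (Fin (m + 1) → ℂ) :=
  LinearEquiv.toContinuousLinearEquiv
    { toFun := fun p => l₀.insertNth (p.1 0) p.2
      invFun := fun y => (fun _ => y l₀, fun l => y (l₀.succAbove l))
      map_add' := fun p q => by
        funext l
        rcases Fin.eq_self_or_eq_succAbove l₀ l with rfl | ⟨j, rfl⟩ <;> simp
      map_smul' := fun c p => by
        funext l
        rcases Fin.eq_self_or_eq_succAbove l₀ l with rfl | ⟨j, rfl⟩ <;> simp
      left_inv := fun p => by
        refine Prod.ext (funext fun i => ?_) (funext fun l => ?_)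
        · simp [Subsingleton.elim i 0]
        · simp
      right_inv := fun y => by
        funext l
        rcases Fin.eq_self_or_eq_succAbove l₀ l with rfl | ⟨j, rfl⟩ <;> simp }

lemma insertEquiv_apply {m : ℕ} (l₀ : Fin (m + 1)) (p : (Fin 1 → ℂ) × (Fin m → ℂ)) :
    insertEquiv l₀ p = l₀.insertNth (p.1 0) p.2 := rfl

section

variable {m : ℕ} {V : Projectivization ℂ (Fin 2 → ℂ) → Projectivization ℂ (Fin (m + 1 + 1) → ℂ)}
  {i : Fin 2} {k : Fin (m + 1 + 1)} {l₀ : Fin (m + 1)} {e : Fin (m + 1) → ℕ}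

/-- In the sheared chart the curve is the inclusion of the axis number `l₀`, the local normal form
of an immersion. -/
lemma IsMonomialInCoord.isImmersionAt (h : IsMonomialInCoord V i k l₀ e)
    {p : Projectivization ℂ (Fin 2 → ℂ)} (hp : p ∈ affineOpen (n := 1) i) :
    Manifold.IsImmersionAtOfComplement (Fin m → ℂ) 𝓘(ℂ, Fin 1 → ℂ) 𝓘(ℂ, Fin (m + 1) → ℂ) ω V p := by
  refine Manifold.IsImmersionAtOfComplement.mk_of_charts (insertEquiv l₀)
    (affineChart (n := 1) i) (shearChart k l₀ e) hp ((h.mem_iff p).2 hp)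
    (affineChart_mem_maximalAtlas (n := 1) i) (shearChart_mem_maximalAtlas k l₀ e)
    (fun q hq => (h.mem_iff q).2 hq) ?_
  intro x _
  have hmem : affineInv (n := 1) i x ∈ affineOpen (n := 1) i :=
    (affineChart (n := 1) i).map_target (mem_univ x)
  have hinv : affineCoord (n := 1) i (affineInv (n := 1) i x) = x :=
    (affineChart (n := 1) i).right_inv (mem_univ x)
  change shear l₀ e (affineCoord k (V (affineInv (n := 1) i x))) = insertEquiv l₀ (x, 0)
  have hco (l : Fin (m + 1)) : affineCoord k (V (affineInv (n := 1) i x)) l = x 0 ^ e l := by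
    rw [h.coord_eq _ hmem, hinv]
  funext l
  rw [insertEquiv_apply]
  change (if l = l₀ then _ else _) = _
  rcases Fin.eq_self_or_eq_succAbove l₀ l with rfl | ⟨j, rfl⟩
  · simp [hco, h.exponent_eq]
  · simp [hco, h.exponent_eq]

/-- Reading off the coordinate `l₀` is a continuous left inverse `R` of the curve. Since the affine
open set `k` pulls back exactly to the affine open set `i`, every point whose image is close to `V
p` lies where `R` inverts `V`. -/
lemma IsMonomialInCoord.comap_nhds_le (h : IsMonomialInCoord V i k l₀ e)
    {p : Projectivization ℂ (Fin 2 → ℂ)} (hp : p ∈ affineOpen (n := 1) i) :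
    comap V (𝓝 (V p)) ≤ 𝓝 p := by
  let R : Projectivization ℂ (Fin (m + 1 + 1) → ℂ) → Projectivization ℂ (Fin 2 → ℂ) :=
    fun q => affineInv (n := 1) i fun _ => affineCoord k q l₀
  have hR (q) (hq : q ∈ affineOpen (n := 1) i) : R (V q) = q := by
    have : (fun _ => affineCoord k (V q) l₀) = affineCoord (n := 1) i q := by
      funext j
      rw [h.coord_eq q hq, h.exponent_eq, pow_one, Subsingleton.elim j 0]
    simp only [R, this]
    exact (affineChart (n := 1) i).left_inv hq
  have hVp : V p ∈ affineOpen k := (h.mem_iff p).2 hp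
  have hRc : ContinuousAt R (V p) := by
    have h1 : ContinuousAt (affineCoord k) (V p) := (affineChart k).continuousAt hVp
    have h2 : Continuous (affineInv (n := 1) i) :=
      continuousOn_univ.1 (affineChart (n := 1) i).continuousOn_symm
    have h3 : Continuous fun y : Fin (m + 1) → ℂ => (fun _ : Fin 1 => y l₀) := by fun_prop
    exact (h2.comp h3).continuousAt.comp h1
  have ht : Tendsto (R ∘ V) (comap V (𝓝 (V p))) (𝓝 p) := by
    have := hRc.tendsto.comp (tendsto_comap (f := V) (x := 𝓝 (V p)))
    rwa [hR p hp] at this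
  have hev : R ∘ V =ᶠ[comap V (𝓝 (V p))] id := by
    filter_upwards [preimage_mem_comap ((isOpen_affineOpen k).mem_nhds hVp)] with q hq
    exact hR q ((h.mem_iff q).1 hq)
  exact tendsto_id'.1 (ht.congr' hev)

end

lemma mem_affineOpen_zero_or_one (p : Projectivization ℂ (Fin 2 → ℂ)) :
    p ∈ affineOpen (n := 1) 0 ∨ p ∈ affineOpen (n := 1) 1 := by
  obtain ⟨i, hi⟩ := exists_mem_affineOpen (n := 1) p
  fin_cases i
  · exact Or.inl hi
  · exact Or.inr hi

lemma injective_veronese (m : ℕ) : Function.Injective (veronese (m + 1)) := by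
  have key {i : Fin 2} {k l₀ e} (h : IsMonomialInCoord (veronese (m + 1)) i k l₀ e) {p q}
      (hp : p ∈ affineOpen (n := 1) i) (hpq : veronese (m + 1) p = veronese (m + 1) q) : p = q := by
    have hq : q ∈ affineOpen (n := 1) i := (h.mem_iff q).1 (hpq ▸ (h.mem_iff p).2 hp)
    refine (affineChart (n := 1) i).injOn hp hq (funext fun j => ?_)
    have h1 := h.coord_eq p hp l₀
    have h2 := h.coord_eq q hq l₀
    rw [h.exponent_eq, pow_one] at h1 h2
    change affineCoord (n := 1) i p j = affineCoord (n := 1) i q j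
    rw [Subsingleton.elim j 0, ← h1, ← h2, hpq]
  intro p q hpq
  rcases mem_affineOpen_zero_or_one p with hp | hp
  · exact key (isMonomialInCoord_zero m) hp hpq
  · exact key (isMonomialInCoord_one m) hp hpq

/-- The rational normal curve is a holomorphic embedding. -/
theorem isSmoothEmbedding_veronese (m : ℕ) :
    Manifold.IsSmoothEmbedding 𝓘(ℂ, Fin 1 → ℂ) 𝓘(ℂ, Fin (m + 1) → ℂ) ω (veronese (m + 1)) where
  isImmersion := by
    refine Manifold.IsImmersionOfComplement.isImmersion (F := Fin m → ℂ) fun p => ?_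
    rcases mem_affineOpen_zero_or_one p with hp | hp
    · exact (isMonomialInCoord_zero m).isImmersionAt hp
    · exact (isMonomialInCoord_one m).isImmersionAt hp
  isEmbedding := by
    refine ⟨Topology.isInducing_iff_nhds.2 fun p => le_antisymm ?_ ?_, injective_veronese m⟩
    · exact map_le_iff_le_comap.1 (continuous_veronese (m + 1)).continuousAt
    · rcases mem_affineOpen_zero_or_one p with hp | hp
      · exact (isMonomialInCoord_zero m).comap_nhds_le hp
      · exact (isMonomialInCoord_one m).comap_nhds_le hp

end CPn

/-! ### The level set as a rational normal curve, and the divisors of the dual sections -/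

namespace Sphere

open MeasureTheory Filter Set

variable {d₁ d₂ : ℤ} {n : ℕ}

/-- The parametrization of `ℙ^{0,1}(L*)₁` by the rational normal curve. -/
noncomputable def levelCurve (hk : d₂ - d₁ = n + 2) (p : Projectivization ℂ (Fin 2 → ℂ)) :
    P01 d₁ d₂ :=
  Projectivization.map (coordEquiv hk).symm.toLinearMap (coordEquiv hk).symm.injective
    (CPn.veronese n p)

lemma coordEquiv_symm_veroneseVec_ne_zero (hk : d₂ - d₁ = n + 2) {v : Fin 2 → ℂ} (hv : v ≠ 0) :
    (coordEquiv hk).symm (CPn.veroneseVec n v) ≠ 0 :=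
  (coordEquiv hk).symm.map_ne_zero_iff.2 (CPn.veroneseVec_ne_zero n hv)

lemma levelCurve_mk (hk : d₂ - d₁ = n + 2) (v : Fin 2 → ℂ) (hv : v ≠ 0) :
    levelCurve hk (Projectivization.mk ℂ v hv) =
      Projectivization.mk ℂ ((coordEquiv hk).symm (CPn.veroneseVec n v))
        (coordEquiv_symm_veroneseVec_ne_zero hk hv) := rfl

lemma map_coordEquiv_levelCurve (hk : d₂ - d₁ = n + 2) (p : Projectivization ℂ (Fin 2 → ℂ)) :
    Projectivization.map (coordEquiv hk).toLinearMap (coordEquiv hk).injective (levelCurve hk p) =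
      CPn.veronese n p := by
  induction p using Projectivization.ind with
  | h v hv =>
    rw [levelCurve_mk, CPn.veronese_mk, Projectivization.map_mk]
    simp

lemma range_levelCurve (hk : d₂ - d₁ = n + 2) :
    Set.range (levelCurve hk) = P01Level d₁ d₂ 1 := by
  ext x
  induction x using Projectivization.ind with
  | h c hc =>
    rw [mem_P01Level_iff hk hc]
    constructor
    · rintro ⟨p, hp⟩
      induction p using Projectivization.ind with
      | h v hv =>
        rw [levelCurve_mk, Projectivization.mk_eq_mk_iff] at hp
        obtain ⟨u, hu⟩ := hp
        refine ⟨v 0, v 1, (u⁻¹ : ℂˣ), ?_, (u⁻¹).ne_zero, fun j => ?_⟩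
        · by_contra! h
          exact hv (funext fun i => by fin_cases i; exacts [h.1, h.2])
        · have : c = (u⁻¹ : ℂˣ) • (coordEquiv hk).symm (CPn.veroneseVec n v) := by
            rw [← hu, inv_smul_smul]
          rw [this, Units.smul_def, map_smul, LinearEquiv.apply_symm_apply]
          rfl
    · rintro ⟨s, t, A, hst, hA, h⟩
      have hv : (![s, t] : Fin 2 → ℂ) ≠ 0 := by
        intro h0
        have h1 := congrFun h0 0
        have h2 := congrFun h0 1
        simp at h1 h2
        simp [h1, h2] at hst
      refine ⟨Projectivization.mk ℂ ![s, t] hv, ?_⟩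
      rw [levelCurve_mk, Projectivization.mk_eq_mk_iff']
      refine ⟨A⁻¹, (coordEquiv hk).injective (funext fun j => ?_)⟩
      rw [map_smul, LinearEquiv.apply_symm_apply, Pi.smul_apply, h, smul_eq_mul,
        inv_mul_cancel_left₀ hA]
      rfl

/-- The divisor of a section whose `H₀`-dual has coordinates in geometric progression. -/
lemma exists_hasDivisor_of_mem_level (hk : d₂ - d₁ = n + 2) (φ : H10 (d₂ - d₁)) {s t A : ℂ}
    (hst : s ≠ 0 ∨ t ≠ 0) (hA : A ≠ 0)
    (h : ∀ j : Fin (n + 1),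
      momentMap hk (dualH0 φ.1) j = A * (s ^ (n - (j : ℕ)) * t ^ (j : ℕ))) :
    ∃ x : OnePoint ℂ, HasDivisor φ (Finsupp.single x (d₂ - d₁ - 2)) := by
  obtain ⟨c, hc⟩ := exists_coeff hk φ
  have hm := gramMass_ne_zero n
  have hm' : conj (2 * gramMass n) ≠ 0 := by simpa using hm
  -- The moments give `2 * gramMass n * conj (c j) = n.choose j * A * s ^ (n - j) * t ^ j`. After
  -- conjugation these are the binomial coefficients of a multiple of `(conj s + conj t * z) ^ n`.
  refine exists_hasDivisor hk φ (A := conj A / conj (2 * gramMass n)) (α := conj s) (β := conj t)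
    (div_ne_zero (by simpa using hA) hm') (by simpa using hst) fun z => ?_
  rw [hc, add_comm (conj s), add_pow, Finset.mul_sum]
  refine Finset.sum_congr rfl fun j hj => ?_
  have h1 := momentMap_dualH0 hk φ.1 c hc ⟨j, Finset.mem_range.1 hj⟩
  rw [h] at h1
  have h2 := congrArg (starRingEnd ℂ) h1
  simp only [map_mul, map_pow, Complex.conj_conj, map_natCast] at h2 hm' ⊢
  rw [div_mul_eq_mul_div, eq_div_iff hm', mul_pow]
  linear_combination (-z ^ j) * h2

end Sphere

/-! ### The main theorem -/

theorem mainTheorem6 (d₁ d₂ : ℤ) (n : ℕ) (hn : 1 ≤ n) (hk : d₂ - d₁ = n + 2) :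
    -- the coefficients `b_j` are linear coordinates on `ℋ^{0,1}(L*)`, hence identify `ℙ^{0,1}(L*)` with `ℂPⁿ`
    ∃ b : Sphere.H01 (-(d₂ - d₁)) ≃ₗ[ℂ] (Fin (n + 1) → ℂ),
      (∀ (η : Sphere.Omega01 (-(d₂ - d₁))) (j : Fin (n + 1)),
        b (Sphere.cls η) j =
          Sphere.coupling (Sphere.monomialSection (d₂ - d₁) j (by have := j.2; omega)) η) ∧
      -- `ℙ^{0,1}(L*)₁` is the set of classes with `div[η] = deg L₂ - 1`
      (∀ (η : Sphere.Omega01 (-(d₂ - d₁))) (hη : Sphere.cls η ≠ 0),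
        Projectivization.mk ℂ (Sphere.cls η) hη ∈ Sphere.P01Level d₁ d₂ 1 ↔
          Sphere.divExt d₁ d₂ η = (((d₂ - 1 : ℤ) : ℝ) : EReal)) ∧
      -- the holomorphic embedding of `ℂP¹` with image `ℙ^{0,1}(L*)₁`
      (∃ Ψ : Projectivization ℂ (Fin 2 → ℂ) → Sphere.P01 d₁ d₂,
        Manifold.IsSmoothEmbedding 𝓘(ℂ, Fin 1 → ℂ) 𝓘(ℂ, Fin n → ℂ) ω
          (fun p => Projectivization.map b.toLinearMap b.injective (Ψ p)) ∧
        Set.range Ψ = Sphere.P01Level d₁ d₂ 1 ∧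
        ∀ (v : Fin 2 → ℂ) (hv : v ≠ 0), ∃ (c : Sphere.H01 (-(d₂ - d₁))) (hc : c ≠ 0),
          Ψ (Projectivization.mk ℂ v hv) = Projectivization.mk ℂ c hc ∧
          ∀ j : Fin (n + 1), b c j = v 0 ^ (n - (j : ℕ)) * v 1 ^ (j : ℕ)) ∧
      -- the `H₀`-dual `ℋ^{1,0}(L) → ℋ^{0,1}(L*)` is bijective, and the dual sections of the classes in
      -- `ℙ^{0,1}(L*)₁` have divisor `(k - 2) x`
      Function.Bijective
        (fun φ : Sphere.H10 (d₂ - d₁) => Sphere.cls (Sphere.dualH0 φ.1)) ∧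
      ∀ (φ : Sphere.H10 (d₂ - d₁)) (hφ : Sphere.cls (Sphere.dualH0 φ.1) ≠ 0),
        Projectivization.mk ℂ (Sphere.cls (Sphere.dualH0 φ.1)) hφ ∈ Sphere.P01Level d₁ d₂ 1 →
        ∃ x : OnePoint ℂ, Sphere.HasDivisor φ (Finsupp.single x (d₂ - d₁ - 2)) := by
  refine ⟨Sphere.coordEquiv hk, fun η j => ?_, fun η hη => ?_, ⟨Sphere.levelCurve hk, ?_,
    Sphere.range_levelCurve hk, fun v hv => ⟨_, Sphere.coordEquiv_symm_veroneseVec_ne_zero hk hv,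
      Sphere.levelCurve_mk hk v hv, fun j => ?_⟩⟩, Sphere.bijective_cls_dualH0 hk, fun φ hφ h => ?_⟩
  · rw [Sphere.coordEquiv_cls, Sphere.momentMap_apply, Sphere.coupling,
      MeasureTheory.integral_const_mul]
    rfl
  · rw [Sphere.mem_P01Level_iff hk hη]
    simp only [Sphere.coordEquiv_cls]
    rw [← Sphere.le_divExt_iff hk hη]
    exact ⟨fun h => le_antisymm (Sphere.divExt_le hk hη) h, fun h => h.ge⟩
  · simp only [Sphere.map_coordEquiv_levelCurve]
    -- This is where `k ≥ 3` enters: for `n = 0` the curve is constant and not an embedding.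
    obtain ⟨m, rfl⟩ : ∃ m, n = m + 1 := ⟨n - 1, by omega⟩
    exact CPn.isSmoothEmbedding_veronese m
  · rw [LinearEquiv.apply_symm_apply]
    rfl
  · obtain ⟨s, t, A, hst, hA, h'⟩ := (Sphere.mem_P01Level_iff hk hφ).1 h
    exact Sphere.exists_hasDivisor_of_mem_level hk φ hst hA h'
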